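/- **Background.** Let $M>0$, $|Q|\le M$, $D(r)=1-\frac{2M}{r}+\frac{Q^2}{r^2}$, $r_+=M+\sqrt{M^2-Q^2}$, and let $r_\star$ be a tortoise coordinate on $(r_+,\infty)$, i.e. $\frac{dr_\star}{dr}=\frac1{D}$. For $(u,v)\in\mathbb R^2$ let $r=r(u,v)>r_+$ be determined by $r_\star(r)=v-u$, so that $g=-2\Omega^2(du\otimes dv+dv\otimes du)+r^2\gamma$, with $\Omega^2=D(r)$ and $\gamma$ the round metric on $S^2$, is the Reissner–Nordström exterior in double null coordinates. Let $S^2_{u,v}$ be the sphere $S^2$ with the metric $\slashed g=r^2\gamma$, volume form $\slashed\varepsilon$ and Levi-Civita connection $\slashed\nabla$. Put $$\mathrm{tr}\chi=\tfrac{2\Omega}{r},\quad \mathrm{tr}\underline\chi=-\tfrac{2\Omega}{r},\quad \omega=\tfrac{M}{r^2}-\tfrac{Q^2}{r^3}=-\underline\omega,\quad \hat\omega=\Omega^{-1}\omega,\quad \hat{\underline\omega}=\Omega^{-1}\underline\omega,\quad \rho=-\tfrac{2M}{r^3}+\tfrac{2Q^2}{r^4},\quad q={}^{(F)}\!\rho=\tfrac{Q}{r^2}.$$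 For an $n$-covariant $S^2_{u,v}$-tensor field $\Theta$, in components with respect to coordinates on $S^2$ independent of $u,v$, the projected derivatives are $\slashed\nabla_3\Theta=\Omega^{-1}\partial_u\Theta-\frac n2\mathrm{tr}\underline\chi\,\Theta$ and $\slashed\nabla_4\Theta=\Omega^{-1}\partial_v\Theta-\frac n2\mathrm{tr}\chi\,\Theta$. Norms are taken with $\slashed g$; $\slashed{\mathrm{div}}$ contracts $\slashed\nabla$ with the first slot, $\slashed{\mathrm{curl}}\,\xi=\slashed\varepsilon^{AB}\slashed\nabla_A\xi_B$, $[\slashed{\mathcal D}_1^\star(f_1,f_2)]_A=-\slashed\nabla_Af_1+\slashed\varepsilon_{AB}\slashed\nabla^Bf_2$, and $\slashed{\mathcal D}_2^\star\xi=-\frac12[\slashed\nabla_A\xi_B+\slashed\nabla_B\xi_A-(\slashed{\mathrm{div}}\xi)\slashed g_{AB}]$. **The linearised Einstein–Maxwell system.** The unknown $\mathcal S$ consists of smooth families, over $(u,v)\in\mathbb R^2$, of functions $\phi$ (the linearised area density divided by the background one), $\overset{(1)}{\Omega}$, $A=\overset{(1)}{(\Omega\mathrm{tr}\chi)}$, $\underline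 A=\overset{(1)}{(\Omega\mathrm{tr}\underline\chi)}$, $\overset{(1)}\omega$, $\overset{(1)}{\underline\omega}$, $\overset{(1)}\rho$, $\overset{(1)}\sigma$, $\overset{(1)}K$, $p={}^{(F)}\!\overset{(1)}\rho$, $s={}^{(F)}\!\overset{(1)}\sigma$; of one-forms $b$, $\eta$, $\underline\eta$, $\beta$, $\underline\beta$, $f={}^{(F)}\!\beta$, $\underline f={}^{(F)}\!\underline\beta$; and of symmetric traceless $2$-tensors $\hat h$ (the traceless linearised metric on the spheres), $\hat\chi$, $\underline{\hat\chi}$, $\alpha$, $\underline\alpha$ on $S^2_{u,v}$ (all linearised quantities). With $w=\Omega^{-1}\overset{(1)}\Omega$, the equations are: *Null structure.* $$\partial_u\phi=\underline A,\qquad \partial_v\phi=A-\slashed{\mathrm{div}}\,b,\qquad r^2\partial_u(r^{-2}\hat h)=2\Omega\underline{\hat\chi},\qquad r^2\partial_v(r^{-2}\hat h)=2\Omega\hat\chi+2\slashed{\mathcal D}_2^\star b,$$ $$\partial_u b^\sharp=2\Omega^2(\eta-\underline\eta)^\sharp\ (\sharp\text{ with respect to }\slashed g),\qquad \partial_vw=\overset{(1)}\omega,\qquad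 \partial_uw=\overset{(1)}{\underline\omega},\qquad 2\slashed\nabla w=\eta+\underline\eta,$$ $$\partial_v\underline A=\Omega^2(2\slashed{\mathrm{div}}\underline\eta+2\overset{(1)}\rho+4\rho w)-\tfrac12\Omega\mathrm{tr}\chi(\underline A-A),\qquad \partial_uA=\Omega^2(2\slashed{\mathrm{div}}\eta+2\overset{(1)}\rho+4\rho w)-\tfrac12\Omega\mathrm{tr}\chi(\underline A-A),$$ $$\partial_vA=-\Omega\mathrm{tr}\chi A+2\omega A+2\Omega\mathrm{tr}\chi\overset{(1)}\omega,\qquad \partial_u\underline A=-\Omega\mathrm{tr}\underline\chi\,\underline A+2\underline\omega\,\underline A+2\Omega\mathrm{tr}\underline\chi\overset{(1)}{\underline\omega},$$ $$\slashed\nabla_3(\Omega^{-1}\underline{\hat\chi})+\Omega^{-1}\mathrm{tr}\underline\chi\,\underline{\hat\chi}=-\Omega^{-1}\underline\alpha,\qquad \slashed\nabla_4(\Omega^{-1}\hat\chi)+\Omega^{-1}\mathrm{tr}\chi\,\hat\chi=-\Omega^{-1}\alpha,$$ $$\slashed\nabla_3(\Omega\hat\chi)+\tfrac12\Omega\mathrm{tr}\underline\chi\,\hat\chi+\tfrac12\Omega\mathrm{tr}\chi\,\underline{\hat\chi}=-2\Omega\slashed{\mathcal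 D}_2^\star\eta,\qquad \slashed\nabla_4(\Omega\underline{\hat\chi})+\tfrac12\Omega\mathrm{tr}\chi\,\underline{\hat\chi}+\tfrac12\Omega\mathrm{tr}\underline\chi\,\hat\chi=-2\Omega\slashed{\mathcal D}_2^\star\underline\eta,$$ $$\slashed\nabla_3\underline\eta=\tfrac12\mathrm{tr}\underline\chi(\eta-\underline\eta)+\underline\beta+q\underline f,\qquad \slashed\nabla_4\eta=-\tfrac12\mathrm{tr}\chi(\eta-\underline\eta)-\beta-qf,$$ $$\slashed\nabla_4\underline\eta=\tfrac2\Omega\slashed\nabla\overset{(1)}\omega-\mathrm{tr}\chi\,\underline\eta+\beta+qf,\qquad \slashed\nabla_3\eta=\tfrac2\Omega\slashed\nabla\overset{(1)}{\underline\omega}-\mathrm{tr}\underline\chi\,\eta-\underline\beta-q\underline f,$$ $$\slashed{\mathrm{curl}}\,\eta=\overset{(1)}\sigma,\qquad \slashed{\mathrm{curl}}\,\underline\eta=-\overset{(1)}\sigma,\qquad \partial_v\overset{(1)}{\underline\omega}=\partial_u\overset{(1)}\omega=-\Omega^2\big(\overset{(1)}\rho+2qp+2(\rho+q^2)w\big),$$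 $$\slashed{\mathrm{div}}\underline{\hat\chi}=-\tfrac12\mathrm{tr}\underline\chi\,\eta+\underline\beta-q\underline f+\tfrac1{2\Omega}\slashed\nabla\underline A,\qquad \slashed{\mathrm{div}}\hat\chi=-\tfrac12\mathrm{tr}\chi\,\underline\eta-\beta+qf+\tfrac1{2\Omega}\slashed\nabla A,$$ $$\overset{(1)}K=-\overset{(1)}\rho+2qp-\tfrac14\tfrac{\mathrm{tr}\chi}{\Omega}(\underline A-A)+\tfrac12w\,\mathrm{tr}\chi\,\mathrm{tr}\underline\chi.$$ *Maxwell.* $$\slashed\nabla_3f+(\tfrac12\mathrm{tr}\underline\chi+\hat{\underline\omega})f=-\slashed{\mathcal D}_1^\star(p,s)+2q\eta,\qquad \slashed\nabla_4\underline f+(\tfrac12\mathrm{tr}\chi+\hat\omega)\underline f=\slashed{\mathcal D}_1^\star(p,-s)-2q\underline\eta,$$ $$\slashed\nabla_3p+\mathrm{tr}\underline\chi\,p=-\slashed{\mathrm{div}}\underline f-\tfrac q\Omega\underline A,\qquad \slashed\nabla_4p+\mathrm{tr}\chi\,p=\slashed{\mathrm{div}}f-\tfrac q\Omega A,$$ $$\slashed\nabla_3s+\mathrm{tr}\underline\chi\,s=\slashed{\mathrm{curl}}\underline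 f,\qquad \slashed\nabla_4s+\mathrm{tr}\chi\,s=\slashed{\mathrm{curl}}f.$$ *Bianchi.* $$\slashed\nabla_3\alpha+(\tfrac12\mathrm{tr}\underline\chi+2\hat{\underline\omega})\alpha=-2\slashed{\mathcal D}_2^\star\beta-3\rho\hat\chi-2q(\slashed{\mathcal D}_2^\star f+q\hat\chi),$$ $$\slashed\nabla_4\underline\alpha+(\tfrac12\mathrm{tr}\chi+2\hat\omega)\underline\alpha=2\slashed{\mathcal D}_2^\star\underline\beta-3\rho\underline{\hat\chi}+2q(\slashed{\mathcal D}_2^\star\underline f-q\underline{\hat\chi}),$$ $$\slashed\nabla_3\beta+(\mathrm{tr}\underline\chi+\hat{\underline\omega})\beta=\slashed{\mathcal D}_1^\star(-\overset{(1)}\rho,\overset{(1)}\sigma)+3\rho\eta+q\big(-\slashed{\mathcal D}_1^\star(p,s)-\mathrm{tr}\chi\underline f-\tfrac12\mathrm{tr}\underline\chi f\big),$$ $$\slashed\nabla_4\underline\beta+(\mathrm{tr}\chi+\hat\omega)\underline\beta=\slashed{\mathcal D}_1^\star(\overset{(1)}\rho,\overset{(1)}\sigma)-3\rho\underline\eta+q\big(\slashed{\mathcal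 D}_1^\star(p,-s)-\mathrm{tr}\underline\chi f-\tfrac12\mathrm{tr}\chi\underline f\big),$$ $$\slashed\nabla_3\underline\beta+(2\mathrm{tr}\underline\chi-\hat{\underline\omega})\underline\beta=-\slashed{\mathrm{div}}\underline\alpha+q(\slashed\nabla_3\underline f-\hat{\underline\omega}\underline f),\qquad \slashed\nabla_4\beta+(2\mathrm{tr}\chi-\hat\omega)\beta=\slashed{\mathrm{div}}\alpha+q(\slashed\nabla_4f-\hat\omega f),$$ $$\slashed\nabla_3\overset{(1)}\rho+\tfrac32\mathrm{tr}\underline\chi\overset{(1)}\rho=-\slashed{\mathrm{div}}\underline\beta-q\,\slashed{\mathrm{div}}\underline f-(\tfrac32\rho+q^2)\tfrac1\Omega\underline A-2\mathrm{tr}\underline\chi\,qp,$$ $$\slashed\nabla_4\overset{(1)}\rho+\tfrac32\mathrm{tr}\chi\overset{(1)}\rho=\slashed{\mathrm{div}}\beta+q\,\slashed{\mathrm{div}}f-(\tfrac32\rho+q^2)\tfrac1\Omega A-2\mathrm{tr}\chi\,qp,$$ $$\slashed\nabla_3\overset{(1)}\sigma+\tfrac32\mathrm{tr}\underline\chi\overset{(1)}\sigma=-\slashed{\mathrm{curl}}\underline\beta-q\,\slashed{\mathrm{curl}}\underline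 f,\qquad \slashed\nabla_4\overset{(1)}\sigma+\tfrac32\mathrm{tr}\chi\overset{(1)}\sigma=-\slashed{\mathrm{curl}}\beta-q\,\slashed{\mathrm{curl}}f.$$ **Fluxes.** With $\varepsilon_{S^2}$ the volume form of the unit sphere, $$E_u[\mathcal S](v_0,v_1)=\int_{v_0}^{v_1}\!\!\int_{S^2}\Big[|\Omega\hat\chi|^2+2|\Omega\underline\eta|^2+2|\Omega f|^2+2|\Omega s|^2+2|\Omega p|^2+rA\big(\overset{(1)}\rho+\slashed{\mathrm{div}}\underline\eta\big)\Big]r^2\,dv\,\varepsilon_{S^2},$$ $$E_v[\mathcal S](u_0,u_1)=\int_{u_0}^{u_1}\!\!\int_{S^2}\Big[|\Omega\underline{\hat\chi}|^2+2|\Omega\eta|^2+2|\Omega\underline f|^2+2|\Omega s|^2+2|\Omega p|^2-r\underline A\big(\overset{(1)}\rho+\slashed{\mathrm{div}}\eta\big)\Big]r^2\,du\,\varepsilon_{S^2}.$$ **Proposition.** Let $-\infty\le u_0\le u_1\le\infty$ and $-\infty\le v_0\le v_1\le\infty$, and let $\mathcal S$ be smooth and satisfy the system at all points with finite $(u,v)\in[u_0,u_1]\times[v_0,v_1]$.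 Then $$E_{u_1}[\mathcal S](v_0,v_1)+E_{v_1}[\mathcal S](u_0,u_1)=E_{u_0}[\mathcal S](v_0,v_1)+E_{v_0}[\mathcal S](u_0,u_1).$$ For finite $u_0,u_1,v_0,v_1$ this holds unconditionally. If some of them are infinite, each flux is understood as the limit of the fluxes with finite parameters as those parameters in it whose prescribed value is $\pm\infty$ tend (jointly) to that value, and the identity is asserted whenever the four limits exist in $\mathbb R$. -/

import Mathlib

open MeasureTheory Filter Topology
open scoped ContDiff

namespace EMDN

/-! ### The Reissner-Nordstrom exterior in double null coordinates -/

/-- Parameters of a Reissner-Nordstrom exterior: mass `M > 0`, charge `|Q| ≤ M`, and the free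
additive constant `c` of the tortoise coordinate. -/
structure RN where
  M : ℝ
  Q : ℝ
  c : ℝ
  M_pos : 0 < M
  Q_le : |Q| ≤ M

namespace RN

/-- The event horizon radius. -/
noncomputable def rPlus (bg : RN) : ℝ := bg.M + Real.sqrt (bg.M ^ 2 - bg.Q ^ 2)

/-- `D(r) = 1 - 2M/r + Q²/r²`. -/
noncomputable def D (bg : RN) (r : ℝ) : ℝ := 1 - 2 * bg.M / r + bg.Q ^ 2 / r ^ 2

/-- The tortoise coordinate: a primitive of `1 / D` on `(r₊, ∞)`. -/
noncomputable def tortoise (bg : RN) (r : ℝ) : ℝ :=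
  bg.c + ∫ s in (2 * bg.rPlus)..r, (bg.D s)⁻¹

theorem rPlus_pos (bg : RN) : 0 < bg.rPlus := by
  have := bg.M_pos
  have := Real.sqrt_nonneg (bg.M ^ 2 - bg.Q ^ 2)
  unfold rPlus
  linarith

theorem D_bounds (bg : RN) {s : ℝ} (hs : bg.rPlus < s) :
    0 < bg.D s ∧ bg.D s ≤ 1 ∧ s * bg.D s ≤ s - bg.rPlus := by
  have hM := bg.M_pos
  have hp := bg.rPlus_pos
  have hs0 : 0 < s := hp.trans hs
  have hQ : bg.Q ^ 2 ≤ bg.M ^ 2 := by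
    have := bg.Q_le
    have h := abs_nonneg bg.Q
    rw [← sq_abs bg.Q]
    nlinarith
  set k := Real.sqrt (bg.M ^ 2 - bg.Q ^ 2) with hk
  have hk0 : 0 ≤ k := Real.sqrt_nonneg _
  have hk2 : k ^ 2 = bg.M ^ 2 - bg.Q ^ 2 := Real.sq_sqrt (by linarith)
  have hr : bg.rPlus = bg.M + k := rfl
  have hkM : k ≤ bg.M := by
    have := sq_nonneg bg.Q
    nlinarith
  have hD : bg.D s = (s - (bg.M + k)) * (s - (bg.M - k)) / s ^ 2 := by
    unfold D
    field_simp
    nlinarith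
  rw [hr] at hs
  have h1 : 0 < s - (bg.M + k) := by linarith
  have h2 : 0 < s - (bg.M - k) := by linarith
  have h3 : s * bg.D s ≤ s - bg.rPlus := by
    rw [hD, hr]
    have : s * ((s - (bg.M + k)) * (s - (bg.M - k)) / s ^ 2)
        = (s - (bg.M + k)) * ((s - (bg.M - k)) / s) := by
      field_simp
    rw [this]
    have h4 : (s - (bg.M - k)) / s ≤ 1 := by
      rw [div_le_one hs0]
      linarith
    nlinarith
  refine ⟨by rw [hD]; positivity, ?_, h3⟩
  by_contra hcon
  push Not at hcon
  nlinarith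

theorem D_continuousOn (bg : RN) : ContinuousOn bg.D (Set.Ioi bg.rPlus) := by
  have hp := bg.rPlus_pos
  have h0 : ∀ s ∈ Set.Ioi bg.rPlus, s ≠ 0 := fun s hs => (hp.trans hs).ne'
  unfold D
  refine ContinuousOn.add (ContinuousOn.sub continuousOn_const
    (ContinuousOn.div continuousOn_const continuousOn_id h0))
    (ContinuousOn.div continuousOn_const (continuousOn_id.pow 2) ?_)
  intro s hs
  exact pow_ne_zero 2 (h0 s hs)

theorem Dinv_continuousOn (bg : RN) :
    ContinuousOn (fun s => (bg.D s)⁻¹) (Set.Ioi bg.rPlus) :=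
  bg.D_continuousOn.inv₀ fun _ hs => (bg.D_bounds hs).1.ne'

theorem Dinv_intervalIntegrable (bg : RN) {a b : ℝ} (ha : bg.rPlus < a) (hb : bg.rPlus < b) :
    IntervalIntegrable (fun s => (bg.D s)⁻¹) volume a b := by
  apply ContinuousOn.intervalIntegrable
  refine bg.Dinv_continuousOn.mono ?_
  intro s hs
  exact lt_of_lt_of_le (lt_min ha hb) hs.1

theorem tortoise_hasDerivAt (bg : RN) {r : ℝ} (hr : bg.rPlus < r) :
    HasDerivAt bg.tortoise (bg.D r)⁻¹ r := by
  have hp := bg.rPlus_pos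
  have hopen : Set.Ioi bg.rPlus ∈ 𝓝 r := Ioi_mem_nhds hr
  refine (intervalIntegral.integral_hasDerivAt_right
    (bg.Dinv_intervalIntegrable (by linarith) hr) ?_ ?_).const_add bg.c
  · exact bg.Dinv_continuousOn.stronglyMeasurableAtFilter isOpen_Ioi r hr
  · exact bg.Dinv_continuousOn.continuousAt hopen

theorem exists_radius (bg : RN) (t : ℝ) : ∃ r, bg.rPlus < r ∧ bg.tortoise r = t := by
  have hp := bg.rPlus_pos
  set x₀ := 2 * bg.rPlus with hx₀
  have hx : bg.rPlus < x₀ := by linarith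
  have hT0 : bg.tortoise x₀ = bg.c := by simp [tortoise, hx₀]
  have hdiff : ∀ r ∈ Set.Ioi bg.rPlus, HasDerivAt bg.tortoise (bg.D r)⁻¹ r :=
    fun r hr => bg.tortoise_hasDerivAt hr
  -- the comparison function `tortoise r - r₊ log (r - r₊) - r` is increasing
  let g : ℝ → ℝ := fun r => bg.tortoise r - (r + bg.rPlus * Real.log (r - bg.rPlus))
  have hg : ∀ r ∈ Set.Ioi bg.rPlus,
      HasDerivAt g ((bg.D r)⁻¹ - (1 + bg.rPlus * ((r - bg.rPlus)⁻¹))) r := by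
    intro r hr
    have h1 : HasDerivAt (fun r : ℝ => Real.log (r - bg.rPlus)) ((r - bg.rPlus)⁻¹) r := by
      have h2 : HasDerivAt (fun r : ℝ => r - bg.rPlus) 1 r := (hasDerivAt_id r).sub_const _
      have h3 := h2.log (sub_pos.2 hr).ne'
      simpa using h3
    exact (hdiff r hr).sub ((hasDerivAt_id r).add (h1.const_mul bg.rPlus))
  have hmono : MonotoneOn g (Set.Ioi bg.rPlus) := by
    refine monotoneOn_of_deriv_nonneg (convex_Ioi _)
      (fun r hr => (hg r hr).continuousAt.continuousWithinAt) ?_ ?_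
    · intro r hr
      rw [interior_Ioi] at hr
      exact (hg r hr).differentiableAt.differentiableWithinAt
    · intro r hr
      rw [interior_Ioi] at hr
      rw [(hg r hr).deriv]
      obtain ⟨hD0, -, hD⟩ := bg.D_bounds hr
      have hr' : 0 < r - bg.rPlus := sub_pos.2 hr
      have h1 : 1 + bg.rPlus * (r - bg.rPlus)⁻¹ = r / (r - bg.rPlus) := by
        field_simp
        ring
      rw [h1, sub_nonneg, div_le_iff₀ hr', inv_mul_eq_div, le_div_iff₀ hD0]
      exact hD
  -- a point where `tortoise` exceeds `t`
  obtain ⟨b, hb, hbt⟩ : ∃ b, x₀ ≤ b ∧ t ≤ bg.tortoise b := by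
    refine ⟨x₀ + |t - bg.c|, by linarith [abs_nonneg (t - bg.c)], ?_⟩
    set b := x₀ + |t - bg.c| with hbdef
    have hb0 : x₀ ≤ b := by linarith [abs_nonneg (t - bg.c)]
    have hb' : bg.rPlus < b := by linarith
    have h := hmono (Set.mem_Ioi.2 hx) (Set.mem_Ioi.2 hb') hb0
    have hlog : Real.log (x₀ - bg.rPlus) ≤ Real.log (b - bg.rPlus) :=
      Real.log_le_log (by linarith) (by linarith)
    have h2 := mul_le_mul_of_nonneg_left hlog hp.le
    simp only [g] at h
    have := le_abs_self (t - bg.c)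
    linarith
  -- a point where `tortoise` is below `t`
  obtain ⟨a, ha, hax, hat⟩ : ∃ a, bg.rPlus < a ∧ a ≤ x₀ ∧ bg.tortoise a ≤ t := by
    set K := |t - bg.c| / bg.rPlus with hK
    have hK0 : 0 ≤ K := by positivity
    have he : Real.exp (-K) ≤ 1 := Real.exp_le_one_iff.2 (by linarith)
    have he0 := Real.exp_pos (-K)
    set a := bg.rPlus + bg.rPlus * Real.exp (-K) with hadef
    have ha : bg.rPlus < a := by
      have := mul_pos hp he0
      linarith
    have hax : a ≤ x₀ := by nlinarith
    refine ⟨a, ha, hax, ?_⟩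
    have h := hmono (Set.mem_Ioi.2 ha) (Set.mem_Ioi.2 hx) hax
    have hl : Real.log (a - bg.rPlus) = Real.log bg.rPlus - K := by
      have : a - bg.rPlus = bg.rPlus * Real.exp (-K) := by rw [hadef]; ring
      rw [this, Real.log_mul hp.ne' he0.ne', Real.log_exp]
      ring
    have hl0 : x₀ - bg.rPlus = bg.rPlus := by rw [hx₀]; ring
    simp only [g] at h
    rw [hl, hl0] at h
    have hKr : bg.rPlus * K = |t - bg.c| := by rw [hK]; field_simp
    have := neg_abs_le (t - bg.c)
    nlinarith
  have hcont : ContinuousOn bg.tortoise (Set.Icc a b) := fun r hr =>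
    (hdiff r (lt_of_lt_of_le ha hr.1)).continuousAt.continuousWithinAt
  obtain ⟨r, hr, hrt⟩ := intermediate_value_Icc (hax.trans hb) hcont ⟨hat, hbt⟩
  exact ⟨r, lt_of_lt_of_le ha hr.1, hrt⟩

/-- The area radius `r(u,v)`: the (unique) `r > r₊` with tortoise coordinate `v - u`. -/
noncomputable def rad (bg : RN) (u v : ℝ) : ℝ := Classical.choose (bg.exists_radius (v - u))

theorem rad_gt (bg : RN) (u v : ℝ) : bg.rPlus < bg.rad u v :=
  (Classical.choose_spec (bg.exists_radius (v - u))).1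

theorem tortoise_rad (bg : RN) (u v : ℝ) : bg.tortoise (bg.rad u v) = v - u :=
  (Classical.choose_spec (bg.exists_radius (v - u))).2

/-- The background lapse `Ω`, with `Ω² = D(r)`. -/
noncomputable def Om (bg : RN) (u v : ℝ) : ℝ := Real.sqrt (bg.D (bg.rad u v))

/-- Background `tr χ`, so `Ω tr χ = 2 Ω² / r`. -/
noncomputable def trchi (bg : RN) (u v : ℝ) : ℝ := 2 * bg.Om u v / bg.rad u v

/-- Background `tr χ̲`. -/
noncomputable def trchib (bg : RN) (u v : ℝ) : ℝ := -(2 * bg.Om u v / bg.rad u v)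

/-- Background `ω`. -/
noncomputable def om (bg : RN) (u v : ℝ) : ℝ :=
  bg.M / bg.rad u v ^ 2 - bg.Q ^ 2 / bg.rad u v ^ 3

/-- Background `ω̲`. -/
noncomputable def omb (bg : RN) (u v : ℝ) : ℝ :=
  -(bg.M / bg.rad u v ^ 2) + bg.Q ^ 2 / bg.rad u v ^ 3

/-- `ω̂ = Ω⁻¹ ω`. -/
noncomputable def omh (bg : RN) (u v : ℝ) : ℝ := (bg.Om u v)⁻¹ * bg.om u v

/-- `ω̲̂ = Ω⁻¹ ω̲`. -/
noncomputable def ombh (bg : RN) (u v : ℝ) : ℝ := (bg.Om u v)⁻¹ * bg.omb u v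

/-- Background Weyl component `ρ`. -/
noncomputable def rho (bg : RN) (u v : ℝ) : ℝ :=
  -(2 * bg.M / bg.rad u v ^ 3) + 2 * bg.Q ^ 2 / bg.rad u v ^ 4

/-- Background electromagnetic component `⁽ᶠ⁾ρ`. -/
noncomputable def rhoF (bg : RN) (u v : ℝ) : ℝ := bg.Q / bg.rad u v ^ 2

end RN

/-! ### Tensor calculus on the spheres `S²_{u,v} = (S², r² γ)`

The unit sphere is `{x : ‖x‖ = 1}` in `ℝ³`. A covariant tensor on it is represented by the
tangential covariant tensor on `ℝ³` along the sphere that restricts to it (it vanishes when one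
slot is the normal `x`), given by its Cartesian components. Only values at unit vectors matter.
For tangential tensors the contraction with the inverse metric `r⁻² γ⁻¹` is `r⁻²` times the
Euclidean contraction, and the Levi-Civita connection of `r² γ`, which is that of `γ`, is the
tangential projection of the Euclidean derivative. -/

abbrev E3 : Type := EuclideanSpace ℝ (Fin 3)

/-- The extension of a function on the unit sphere that is constant along rays. -/
noncomputable def rayExt {V : Type} (f : E3 → V) (x : E3) : V := f (‖x‖⁻¹ • x)

/-- The `k`-th Cartesian derivative of the ray-constant extension. -/
noncomputable def pd (f : E3 → ℝ) (x : E3) (k : Fin 3) : ℝ :=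
  fderiv ℝ (rayExt f) x (EuclideanSpace.single k 1)

/-- The tangential projection `δ_{ab} - x_a x_b`; it is also the round metric `γ_{ab}`. -/
noncomputable def proj (x : E3) (a b : Fin 3) : ℝ := (if a = b then 1 else 0) - x a * x b

/-- The volume form of the unit round sphere, `det (x, e_a, e_b)`. -/
noncomputable def vol (x : E3) (a b : Fin 3) : ℝ :=
  Matrix.det (Matrix.of ![fun i => x i, Pi.single a 1, Pi.single b 1])

/-- `(∇ f)_a`. -/
noncomputable def grad (f : E3 → ℝ) (x : E3) : Fin 3 → ℝ := fun a =>
  ∑ k, proj x a k * pd f x k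

/-- `(∇_a ξ)_b`. -/
noncomputable def cov1 (ξ : E3 → Fin 3 → ℝ) (x : E3) (a b : Fin 3) : ℝ :=
  ∑ k, ∑ l, proj x a k * proj x b l * pd (fun y => ξ y l) x k

/-- `(∇_a Θ)_{bc}`. -/
noncomputable def cov2 (Θ : E3 → Fin 3 → Fin 3 → ℝ) (x : E3) (a b c : Fin 3) : ℝ :=
  ∑ k, ∑ l, ∑ m, proj x a k * proj x b l * proj x c m * pd (fun y => Θ y l m) x k

/-- Inner product of one-forms with respect to `r² γ`. -/
noncomputable def inner1 (r : ℝ) (ξ ζ : Fin 3 → ℝ) : ℝ := (r ^ 2)⁻¹ * ∑ a, ξ a * ζ a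

/-- Inner product of covariant `2`-tensors with respect to `r² γ`. -/
noncomputable def inner2 (r : ℝ) (Θ Φ : Fin 3 → Fin 3 → ℝ) : ℝ :=
  (r ^ 2)⁻¹ * (r ^ 2)⁻¹ * ∑ a, ∑ b, Θ a b * Φ a b

/-- Divergence of a one-form with respect to `r² γ`. -/
noncomputable def div1 (r : ℝ) (ξ : E3 → Fin 3 → ℝ) (x : E3) : ℝ :=
  (r ^ 2)⁻¹ * ∑ a, cov1 ξ x a a

/-- Divergence of a covariant `2`-tensor with respect to `r² γ`. -/
noncomputable def div2 (r : ℝ) (Θ : E3 → Fin 3 → Fin 3 → ℝ) (x : E3) : Fin 3 → ℝ := fun b =>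
  (r ^ 2)⁻¹ * ∑ a, cov2 Θ x a a b

/-- Curl `ε^{ab} ∇_a ξ_b` of a one-form with respect to `r² γ`, whose volume form is `r² vol`. -/
noncomputable def curl (r : ℝ) (ξ : E3 → Fin 3 → ℝ) (x : E3) : ℝ :=
  (r ^ 2)⁻¹ * (r ^ 2)⁻¹ * ∑ a, ∑ b, (r ^ 2 * vol x a b) * cov1 ξ x a b

/-- `D₁*(f₁, f₂)_a = -∇_a f₁ + ε_{ab} ∇^b f₂`. -/
noncomputable def D1star (r : ℝ) (f₁ f₂ : E3 → ℝ) (x : E3) : Fin 3 → ℝ := fun a =>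
  -grad f₁ x a + ∑ b, (r ^ 2 * vol x a b) * ((r ^ 2)⁻¹ * grad f₂ x b)

/-- `D₂* ξ = -½ (∇_a ξ_b + ∇_b ξ_a - (div ξ) g_{ab})`, with `g = r² γ`. -/
noncomputable def D2star (r : ℝ) (ξ : E3 → Fin 3 → ℝ) (x : E3) : Fin 3 → Fin 3 → ℝ :=
  fun a b => -(1 / 2) * (cov1 ξ x a b + cov1 ξ x b a - div1 r ξ x * (r ^ 2 * proj x a b))

/-! ### Fields on the exterior and their null derivatives -/

/-- Families of `S²_{u,v}`-tensors with Cartesian components in `V`. The tensors on different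
spheres are compared through the coordinates `(u, v, θ, φ)`, so that for covariant tensors
`∂_u` and `∂_v` below are derivatives of components with respect to these coordinates. -/
abbrev Field (V : Type) : Type := ℝ → ℝ → E3 → V

abbrev Scal : Type := Field ℝ
abbrev OneForm : Type := Field (Fin 3 → ℝ)
abbrev Tens2 : Type := Field (Fin 3 → Fin 3 → ℝ)

/-- `∂_u`. -/
noncomputable def dU {V : Type} [NormedAddCommGroup V] [NormedSpace ℝ V] (F : Field V) :
    Field V := fun u v x => deriv (fun s => F s v x) u

/-- `∂_v`. -/
noncomputable def dV {V : Type} [NormedAddCommGroup V] [NormedSpace ℝ V] (F : Field V) :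
    Field V := fun u v x => deriv (fun s => F u s x) v

/-- The projected derivative `∇₃` on `n`-covariant tensors: `e₃` of the coordinate components
minus `½ tr χ̲` for each of the `n` slots, `e₃ = Ω⁻¹ ∂_u`. -/
noncomputable def nab3 (bg : RN) (n : ℕ) {V : Type} [NormedAddCommGroup V] [NormedSpace ℝ V]
    (F : Field V) : Field V := fun u v x =>
  (bg.Om u v)⁻¹ • dU F u v x - ((n : ℝ) / 2 * bg.trchib u v) • F u v x

/-- The projected derivative `∇₄` on `n`-covariant tensors. -/
noncomputable def nab4 (bg : RN) (n : ℕ) {V : Type} [NormedAddCommGroup V] [NormedSpace ℝ V]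
    (F : Field V) : Field V := fun u v x =>
  (bg.Om u v)⁻¹ • dV F u v x - ((n : ℝ) / 2 * bg.trchi u v) • F u v x

/-- Smoothness on `ℝ × ℝ × S²`: the ray-constant extension is smooth away from the origin. -/
def SmoothField {V : Type} [NormedAddCommGroup V] [NormedSpace ℝ V] (F : Field V) : Prop :=
  ContDiffOn ℝ ∞ (fun p : ℝ × ℝ × E3 => rayExt (F p.1 p.2.1) p.2.2) {p | p.2.2 ≠ 0}

/-- `F` is a smooth function on the exterior. -/
def IsScal (F : Scal) : Prop := SmoothField F

/-- `F` is a smooth family of one-forms on the spheres. -/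
def IsOneForm (F : OneForm) : Prop :=
  SmoothField F ∧ ∀ u v (x : E3), ‖x‖ = 1 → ∑ a, x a * F u v x a = 0

/-- `F` is a smooth family of symmetric traceless covariant `2`-tensors on the spheres. -/
def IsSymTraceless (F : Tens2) : Prop :=
  SmoothField F ∧ ∀ u v (x : E3), ‖x‖ = 1 →
    (∀ b, ∑ a, x a * F u v x a b = 0) ∧ (∀ a b, F u v x a b = F u v x b a) ∧
      ∑ a, F u v x a a = 0

/-! ### The linearised Einstein-Maxwell system -/

/-- The linearised quantities. A trailing `b` in a name is an underline and a trailing `F` marks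
electromagnetic components. -/
structure Pert where
  /-- traceless part of the linearised metric on the spheres -/
  gHat : Tens2
  /-- linearised volume density of the spheres divided by the background density -/
  sqrtG : Scal
  /-- linearised lapse `Ω⁽¹⁾` -/
  Om1 : Scal
  /-- linearised shift, as a one-form -/
  shift : OneForm
  /-- `(Ω tr χ)⁽¹⁾` -/
  Otrchi : Scal
  /-- `(Ω tr χ̲)⁽¹⁾` -/
  Otrchib : Scal
  chih : Tens2
  chihb : Tens2
  etab : OneForm
  eta : OneForm
  om1 : Scal
  om1b : Scal
  alpha : Tens2
  beta : OneForm
  rho1 : Scal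
  sigma1 : Scal
  betab : OneForm
  alphab : Tens2
  K1 : Scal
  betaF : OneForm
  rho1F : Scal
  sigma1F : Scal
  betabF : OneForm

namespace Pert

/-- `Ω⁻¹ Ω⁽¹⁾`. -/
noncomputable def lapse (S : Pert) (bg : RN) : Scal := fun u v x => (bg.Om u v)⁻¹ * S.Om1 u v x

/-- All components are smooth tensors on the spheres of the appropriate kind. -/
structure IsSmooth (S : Pert) : Prop where
  gHat : IsSymTraceless S.gHat
  sqrtG : IsScal S.sqrtG
  Om1 : IsScal S.Om1
  shift : IsOneForm S.shift
  Otrchi : IsScal S.Otrchi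
  Otrchib : IsScal S.Otrchib
  chih : IsSymTraceless S.chih
  chihb : IsSymTraceless S.chihb
  etab : IsOneForm S.etab
  eta : IsOneForm S.eta
  om1 : IsScal S.om1
  om1b : IsScal S.om1b
  alpha : IsSymTraceless S.alpha
  beta : IsOneForm S.beta
  rho1 : IsScal S.rho1
  sigma1 : IsScal S.sigma1
  betab : IsOneForm S.betab
  alphab : IsSymTraceless S.alphab
  K1 : IsScal S.K1
  betaF : IsOneForm S.betaF
  rho1F : IsScal S.rho1F
  sigma1F : IsScal S.sigma1F
  betabF : IsOneForm S.betabF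

/-- Linearised null structure equations, at the point `(u, v, x)`. The background density of the
spheres is `r²` times that of the unit sphere. The equation for the shift is the one for the vector
field `b^A = r⁻² γ^{AB} b_B`, namely `∂_u b^A = 2 Ω² (η - η̲)^A`, with the index lowered. -/
structure NullStructureAt (bg : RN) (S : Pert) (u v : ℝ) (x : E3) : Prop where
  sqrtG_u : dU S.sqrtG u v x = S.Otrchib u v x
  sqrtG_v : dV S.sqrtG u v x = S.Otrchi u v x - div1 (bg.rad u v) (S.shift u v) x
  gHat_u : bg.rad u v ^ 2 • dU (fun u v x => (bg.rad u v ^ 2)⁻¹ • S.gHat u v x) u v x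
    = (2 * bg.Om u v) • S.chihb u v x
  gHat_v : bg.rad u v ^ 2 • dV (fun u v x => (bg.rad u v ^ 2)⁻¹ • S.gHat u v x) u v x
    = (2 * bg.Om u v) • S.chih u v x + (2 : ℝ) • D2star (bg.rad u v) (S.shift u v) x
  shift_u : bg.rad u v ^ 2 • dU (fun u v x => (bg.rad u v ^ 2)⁻¹ • S.shift u v x) u v x
    = (2 * bg.Om u v ^ 2) • (S.eta u v x - S.etab u v x)
  lapse_v : dV (S.lapse bg) u v x = S.om1 u v x
  lapse_u : dU (S.lapse bg) u v x = S.om1b u v x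
  lapse_grad : (2 : ℝ) • grad (S.lapse bg u v) x = S.eta u v x + S.etab u v x
  Otrchib_v : dV S.Otrchib u v x
    = bg.Om u v ^ 2 * (2 * div1 (bg.rad u v) (S.etab u v) x + 2 * S.rho1 u v x
        + 4 * bg.rho u v * S.lapse bg u v x)
      - 1 / 2 * (bg.Om u v * bg.trchi u v) * (S.Otrchib u v x - S.Otrchi u v x)
  Otrchi_u : dU S.Otrchi u v x
    = bg.Om u v ^ 2 * (2 * div1 (bg.rad u v) (S.eta u v) x + 2 * S.rho1 u v x
        + 4 * bg.rho u v * S.lapse bg u v x)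
      - 1 / 2 * (bg.Om u v * bg.trchi u v) * (S.Otrchib u v x - S.Otrchi u v x)
  Otrchi_v : dV S.Otrchi u v x
    = -(bg.Om u v * bg.trchi u v) * S.Otrchi u v x + 2 * bg.om u v * S.Otrchi u v x
      + 2 * (bg.Om u v * bg.trchi u v) * S.om1 u v x
  Otrchib_u : dU S.Otrchib u v x
    = -(bg.Om u v * bg.trchib u v) * S.Otrchib u v x + 2 * bg.omb u v * S.Otrchib u v x
      + 2 * (bg.Om u v * bg.trchib u v) * S.om1b u v x
  chihb_3 : nab3 bg 2 (fun u v x => (bg.Om u v)⁻¹ • S.chihb u v x) u v x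
      + ((bg.Om u v)⁻¹ * bg.trchib u v) • S.chihb u v x
    = -((bg.Om u v)⁻¹ • S.alphab u v x)
  chih_4 : nab4 bg 2 (fun u v x => (bg.Om u v)⁻¹ • S.chih u v x) u v x
      + ((bg.Om u v)⁻¹ * bg.trchi u v) • S.chih u v x
    = -((bg.Om u v)⁻¹ • S.alpha u v x)
  chih_3 : nab3 bg 2 (fun u v x => bg.Om u v • S.chih u v x) u v x
      + (1 / 2 * (bg.Om u v * bg.trchib u v)) • S.chih u v x
      + (1 / 2 * (bg.Om u v * bg.trchi u v)) • S.chihb u v x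
    = -(2 * bg.Om u v) • D2star (bg.rad u v) (S.eta u v) x
  chihb_4 : nab4 bg 2 (fun u v x => bg.Om u v • S.chihb u v x) u v x
      + (1 / 2 * (bg.Om u v * bg.trchi u v)) • S.chihb u v x
      + (1 / 2 * (bg.Om u v * bg.trchib u v)) • S.chih u v x
    = -(2 * bg.Om u v) • D2star (bg.rad u v) (S.etab u v) x
  etab_3 : nab3 bg 1 S.etab u v x
    = (1 / 2 * bg.trchib u v) • (S.eta u v x - S.etab u v x)
      + S.betab u v x + bg.rhoF u v • S.betabF u v x
  eta_4 : nab4 bg 1 S.eta u v x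
    = -(1 / 2 * bg.trchi u v) • (S.eta u v x - S.etab u v x)
      - S.beta u v x - bg.rhoF u v • S.betaF u v x
  etab_4 : nab4 bg 1 S.etab u v x
    = (2 / bg.Om u v) • grad (S.om1 u v) x - bg.trchi u v • S.etab u v x
      + S.beta u v x + bg.rhoF u v • S.betaF u v x
  eta_3 : nab3 bg 1 S.eta u v x
    = (2 / bg.Om u v) • grad (S.om1b u v) x - bg.trchib u v • S.eta u v x
      - S.betab u v x - bg.rhoF u v • S.betabF u v x
  curl_eta : curl (bg.rad u v) (S.eta u v) x = S.sigma1 u v x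
  curl_etab : curl (bg.rad u v) (S.etab u v) x = -S.sigma1 u v x
  om1b_v : dV S.om1b u v x
    = -(bg.Om u v ^ 2) * (S.rho1 u v x + 2 * bg.rhoF u v * S.rho1F u v x
        + 2 * (bg.rho u v + bg.rhoF u v ^ 2) * S.lapse bg u v x)
  om1_u : dU S.om1 u v x
    = -(bg.Om u v ^ 2) * (S.rho1 u v x + 2 * bg.rhoF u v * S.rho1F u v x
        + 2 * (bg.rho u v + bg.rhoF u v ^ 2) * S.lapse bg u v x)
  codazzi_chihb : div2 (bg.rad u v) (S.chihb u v) x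
    = -(1 / 2 * bg.trchib u v) • S.eta u v x + S.betab u v x - bg.rhoF u v • S.betabF u v x
      + (1 / (2 * bg.Om u v)) • grad (S.Otrchib u v) x
  codazzi_chih : div2 (bg.rad u v) (S.chih u v) x
    = -(1 / 2 * bg.trchi u v) • S.etab u v x - S.beta u v x + bg.rhoF u v • S.betaF u v x
      + (1 / (2 * bg.Om u v)) • grad (S.Otrchi u v) x
  gauss : S.K1 u v x
    = -S.rho1 u v x + 2 * bg.rhoF u v * S.rho1F u v x
      - 1 / 4 * (bg.trchi u v / bg.Om u v) * (S.Otrchib u v x - S.Otrchi u v x)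
      + 1 / 2 * S.lapse bg u v x * (bg.trchi u v * bg.trchib u v)

/-- Linearised Maxwell equations, at the point `(u, v, x)`. -/
structure MaxwellAt (bg : RN) (S : Pert) (u v : ℝ) (x : E3) : Prop where
  betaF_3 : nab3 bg 1 S.betaF u v x + (1 / 2 * bg.trchib u v + bg.ombh u v) • S.betaF u v x
    = -D1star (bg.rad u v) (S.rho1F u v) (S.sigma1F u v) x
      + (2 * bg.rhoF u v) • S.eta u v x
  betabF_4 : nab4 bg 1 S.betabF u v x + (1 / 2 * bg.trchi u v + bg.omh u v) • S.betabF u v x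
    = D1star (bg.rad u v) (S.rho1F u v) (fun y => -S.sigma1F u v y) x
      - (2 * bg.rhoF u v) • S.etab u v x
  rho1F_3 : nab3 bg 0 S.rho1F u v x + bg.trchib u v * S.rho1F u v x
    = -div1 (bg.rad u v) (S.betabF u v) x - bg.rhoF u v / bg.Om u v * S.Otrchib u v x
  rho1F_4 : nab4 bg 0 S.rho1F u v x + bg.trchi u v * S.rho1F u v x
    = div1 (bg.rad u v) (S.betaF u v) x - bg.rhoF u v / bg.Om u v * S.Otrchi u v x
  sigma1F_3 : nab3 bg 0 S.sigma1F u v x + bg.trchib u v * S.sigma1F u v x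
    = curl (bg.rad u v) (S.betabF u v) x
  sigma1F_4 : nab4 bg 0 S.sigma1F u v x + bg.trchi u v * S.sigma1F u v x
    = curl (bg.rad u v) (S.betaF u v) x

/-- Linearised Bianchi identities, at the point `(u, v, x)`. -/
structure BianchiAt (bg : RN) (S : Pert) (u v : ℝ) (x : E3) : Prop where
  alpha_3 : nab3 bg 2 S.alpha u v x + (1 / 2 * bg.trchib u v + 2 * bg.ombh u v) • S.alpha u v x
    = -((2 : ℝ) • D2star (bg.rad u v) (S.beta u v) x) - (3 * bg.rho u v) • S.chih u v x
      - (2 * bg.rhoF u v) •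
        (D2star (bg.rad u v) (S.betaF u v) x + bg.rhoF u v • S.chih u v x)
  alphab_4 : nab4 bg 2 S.alphab u v x + (1 / 2 * bg.trchi u v + 2 * bg.omh u v) • S.alphab u v x
    = (2 : ℝ) • D2star (bg.rad u v) (S.betab u v) x - (3 * bg.rho u v) • S.chihb u v x
      + (2 * bg.rhoF u v) •
        (D2star (bg.rad u v) (S.betabF u v) x - bg.rhoF u v • S.chihb u v x)
  beta_3 : nab3 bg 1 S.beta u v x + (bg.trchib u v + bg.ombh u v) • S.beta u v x
    = D1star (bg.rad u v) (fun y => -S.rho1 u v y) (S.sigma1 u v) x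
      + (3 * bg.rho u v) • S.eta u v x
      + bg.rhoF u v • (-D1star (bg.rad u v) (S.rho1F u v) (S.sigma1F u v) x
        - bg.trchi u v • S.betabF u v x - (1 / 2 * bg.trchib u v) • S.betaF u v x)
  betab_4 : nab4 bg 1 S.betab u v x + (bg.trchi u v + bg.omh u v) • S.betab u v x
    = D1star (bg.rad u v) (S.rho1 u v) (S.sigma1 u v) x
      - (3 * bg.rho u v) • S.etab u v x
      + bg.rhoF u v • (D1star (bg.rad u v) (S.rho1F u v) (fun y => -S.sigma1F u v y) x
        - bg.trchib u v • S.betaF u v x - (1 / 2 * bg.trchi u v) • S.betabF u v x)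
  betab_3 : nab3 bg 1 S.betab u v x + (2 * bg.trchib u v - bg.ombh u v) • S.betab u v x
    = -div2 (bg.rad u v) (S.alphab u v) x
      + bg.rhoF u v • (nab3 bg 1 S.betabF u v x - bg.ombh u v • S.betabF u v x)
  beta_4 : nab4 bg 1 S.beta u v x + (2 * bg.trchi u v - bg.omh u v) • S.beta u v x
    = div2 (bg.rad u v) (S.alpha u v) x
      + bg.rhoF u v • (nab4 bg 1 S.betaF u v x - bg.omh u v • S.betaF u v x)
  rho1_3 : nab3 bg 0 S.rho1 u v x + 3 / 2 * bg.trchib u v * S.rho1 u v x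
    = -div1 (bg.rad u v) (S.betab u v) x - bg.rhoF u v * div1 (bg.rad u v) (S.betabF u v) x
      - (3 / 2 * bg.rho u v + bg.rhoF u v ^ 2) * (1 / bg.Om u v) * S.Otrchib u v x
      - 2 * bg.trchib u v * bg.rhoF u v * S.rho1F u v x
  rho1_4 : nab4 bg 0 S.rho1 u v x + 3 / 2 * bg.trchi u v * S.rho1 u v x
    = div1 (bg.rad u v) (S.beta u v) x + bg.rhoF u v * div1 (bg.rad u v) (S.betaF u v) x
      - (3 / 2 * bg.rho u v + bg.rhoF u v ^ 2) * (1 / bg.Om u v) * S.Otrchi u v x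
      - 2 * bg.trchi u v * bg.rhoF u v * S.rho1F u v x
  sigma1_3 : nab3 bg 0 S.sigma1 u v x + 3 / 2 * bg.trchib u v * S.sigma1 u v x
    = -curl (bg.rad u v) (S.betab u v) x - bg.rhoF u v * curl (bg.rad u v) (S.betabF u v) x
  sigma1_4 : nab4 bg 0 S.sigma1 u v x + 3 / 2 * bg.trchi u v * S.sigma1 u v x
    = -curl (bg.rad u v) (S.beta u v) x - bg.rhoF u v * curl (bg.rad u v) (S.betaF u v) x

/-- `S` is smooth and solves the linearised Einstein-Maxwell system at all points of the spheres
`S²_{u,v}` with `(u, v) ∈ R`. -/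
structure IsSolutionOn (bg : RN) (S : Pert) (R : Set (ℝ × ℝ)) : Prop where
  smooth : S.IsSmooth
  nullStructure : ∀ u v, (u, v) ∈ R → ∀ x : E3, ‖x‖ = 1 → NullStructureAt bg S u v x
  maxwell : ∀ u v, (u, v) ∈ R → ∀ x : E3, ‖x‖ = 1 → MaxwellAt bg S u v x
  bianchi : ∀ u v, (u, v) ∈ R → ∀ x : E3, ‖x‖ = 1 → BianchiAt bg S u v x

/-! ### The fluxes -/

/-- Density of the flux through the outgoing cone `C_u`. -/
noncomputable def densityU (S : Pert) (bg : RN) : Scal := fun u v x =>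
  (inner2 (bg.rad u v) (bg.Om u v • S.chih u v x) (bg.Om u v • S.chih u v x)
    + 2 * inner1 (bg.rad u v) (bg.Om u v • S.etab u v x) (bg.Om u v • S.etab u v x)
    + 2 * inner1 (bg.rad u v) (bg.Om u v • S.betaF u v x) (bg.Om u v • S.betaF u v x)
    + 2 * (bg.Om u v * S.sigma1F u v x) ^ 2
    + 2 * (bg.Om u v * S.rho1F u v x) ^ 2
    + bg.rad u v * S.Otrchi u v x * (S.rho1 u v x + div1 (bg.rad u v) (S.etab u v) x))
  * bg.rad u v ^ 2

/-- Density of the flux through the ingoing cone `C̲_v`. -/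
noncomputable def densityV (S : Pert) (bg : RN) : Scal := fun u v x =>
  (inner2 (bg.rad u v) (bg.Om u v • S.chihb u v x) (bg.Om u v • S.chihb u v x)
    + 2 * inner1 (bg.rad u v) (bg.Om u v • S.eta u v x) (bg.Om u v • S.eta u v x)
    + 2 * inner1 (bg.rad u v) (bg.Om u v • S.betabF u v x) (bg.Om u v • S.betabF u v x)
    + 2 * (bg.Om u v * S.sigma1F u v x) ^ 2
    + 2 * (bg.Om u v * S.rho1F u v x) ^ 2
    - bg.rad u v * S.Otrchib u v x * (S.rho1 u v x + div1 (bg.rad u v) (S.eta u v) x))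
  * bg.rad u v ^ 2

end Pert

/-- Integral over the unit sphere against its standard surface measure (of total mass `4π`). -/
noncomputable def sphereIntegral (f : E3 → ℝ) : ℝ :=
  ∫ x : Metric.sphere (0 : E3) 1, f x ∂((volume : Measure E3).toSphere)

namespace Pert

/-- The flux `E_u[S](v₀, v₁)`. -/
noncomputable def fluxU (S : Pert) (bg : RN) (u v₀ v₁ : ℝ) : ℝ :=
  ∫ v in v₀..v₁, sphereIntegral (S.densityU bg u v)

/-- The flux `E_v[S](u₀, u₁)`. -/
noncomputable def fluxV (S : Pert) (bg : RN) (v u₀ u₁ : ℝ) : ℝ :=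
  ∫ u in u₀..u₁, sphereIntegral (S.densityV bg u v)

end Pert

/-- How a finite parameter approaches an extended endpoint `e`: it equals `e` if `e` is finite, and
tends to `±∞` if `e = ±∞`. -/
noncomputable def approach (e : EReal) : Filter ℝ :=
  if e = ⊤ then atTop else if e = ⊥ then atBot else pure e.toReal

namespace Pert

/-- The flux `E_u[S](v₀, v₁)` with extended parameters exists and equals `L`: it is the limit of the
fluxes with finite parameters as these approach `u`, `v₀`, `v₁`. -/
def HasFluxU (S : Pert) (bg : RN) (u v₀ v₁ : EReal) (L : ℝ) : Prop :=
  Tendsto (fun p : ℝ × ℝ × ℝ => S.fluxU bg p.1 p.2.1 p.2.2)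
    (approach u ×ˢ (approach v₀ ×ˢ approach v₁)) (𝓝 L)

/-- The flux `E_v[S](u₀, u₁)` with extended parameters exists and equals `L`. -/
def HasFluxV (S : Pert) (bg : RN) (v u₀ u₁ : EReal) (L : ℝ) : Prop :=
  Tendsto (fun p : ℝ × ℝ × ℝ => S.fluxV bg p.1 p.2.1 p.2.2)
    (approach v ×ˢ (approach u₀ ×ˢ approach u₁)) (𝓝 L)

end Pert

/-- The points with finite coordinates of the characteristic rectangle `[u₀, u₁] × [v₀, v₁]`. -/
def rectangle (u₀ u₁ v₀ v₁ : EReal) : Set (ℝ × ℝ) :=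
  {p | u₀ ≤ (p.1 : EReal) ∧ (p.1 : EReal) ≤ u₁ ∧ v₀ ≤ (p.2 : EReal) ∧ (p.2 : EReal) ≤ v₁}

end EMDN

/-! The two flux densities form a current that is conserved up to angular divergences. Let F and G
be the densities in `densityU` and `densityV`, weight r² included. On every sphere where the
equations hold, ∂_u F + ∂_v G is the divergence of a smooth tangential one-form
(`isSphereDiv_fluxDensity`). It therefore integrates to zero over the sphere
(`sphereIntegral_sdiv`), and integration over a rectangle leaves only the four boundary terms
(`flux_balance`).

The divergence identity rests on the following cancellations, with q the background Maxwell
component and w the linearised lapse over Ω. In ∂_u of ρ + div η̲ the terms in div β̲ and q div f̲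
cancel, and so do their counterparts in ∂_v of ρ + div η. The terms in χ̂ · D₂*η and χ̲̂ · D₂*η̲ are
integrated by parts onto div χ̂ and div χ̲̂. The Codazzi equations then turn them into products of
η, η̲ with β, β̲, f, f̲, which cancel against the evolution of |η|², |η̲|², |f|², |f̲|², and into
gradients of A and A̲, which combine with A div η and A̲ div η̲ into divergences. The Maxwell terms
pair off as p div f + f · ∇p and as a rotated analogue with s and curl f, likewise for f̲. The
product (ρ + div η)(ρ + div η̲) drops out of the sum, leaving a multiple of w (div η̲ − div η).
After integration by parts, 2∇w = η + η̲ makes this a multiple of |η|² − |η̲|², which the derivative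
of Ω² in front of |η|² and |η̲|² removes because ω = −rρ/2 on the background.

Calculus on the spheres is done with Cartesian components of ray-constant extensions. The tangential
projections in the covariant operators disappear once these are traced or paired with tangential
tensors, so each integration by parts is a product rule.

For infinite endpoints the identity on finite rectangles is passed to the limit along one filter for
all four parameters. Rectangles whose two u-endpoints or two v-endpoints coincide are settled
separately by antisymmetry of the flux in its limits of integration (`eq_zero_of_antisymm_limit`).
-/

namespace EMDN

/-! ### Calculus on the unit sphere -/

/-- Smoothness of a function on the unit sphere. -/
def SphereSmooth (f : E3 → ℝ) : Prop := ContDiffOn ℝ ∞ (rayExt f) {x | x ≠ 0}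

theorem ne_zero_of_unit {x : E3} (hx : ‖x‖ = 1) : x ≠ 0 := by
  rintro rfl
  simp at hx

theorem rayExt_of_unit {V : Type} (f : E3 → V) {x : E3} (hx : ‖x‖ = 1) : rayExt f x = f x := by
  simp [rayExt, hx]

theorem norm_normalize {x : E3} (hx : x ≠ 0) : ‖‖x‖⁻¹ • x‖ = 1 := by
  rw [norm_smul, norm_inv, norm_norm, inv_mul_cancel₀ (norm_ne_zero_iff.2 hx)]

theorem rayExt_smul {V : Type} (f : E3 → V) {c : ℝ} (hc : 0 < c) (x : E3) :
    rayExt f (c • x) = rayExt f x := by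
  unfold rayExt
  rw [norm_smul, Real.norm_of_nonneg hc.le, smul_smul, mul_inv, mul_right_comm,
    inv_mul_cancel₀ hc.ne', one_mul]

theorem isOpen_nonzero : IsOpen {x : E3 | x ≠ 0} := isOpen_ne

theorem contDiffOn_normalize : ContDiffOn ℝ ∞ (fun x : E3 => ‖x‖⁻¹ • x) {x | x ≠ 0} := by
  intro x hx
  have h : ContDiffAt ℝ ∞ (fun x : E3 => ‖x‖) x := contDiffAt_norm ℝ hx
  exact ((h.inv (norm_ne_zero_iff.2 hx)).smul contDiffAt_id).contDiffWithinAt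

namespace SphereSmooth

variable {f g : E3 → ℝ}

theorem contDiffAt (hf : SphereSmooth f) {x : E3} (hx : x ≠ 0) : ContDiffAt ℝ ∞ (rayExt f) x :=
  ContDiffOn.contDiffAt hf (isOpen_nonzero.mem_nhds hx)

theorem differentiableAt (hf : SphereSmooth f) {x : E3} (hx : x ≠ 0) :
    DifferentiableAt ℝ (rayExt f) x :=
  (hf.contDiffAt hx).differentiableAt (by simp)

theorem add (hf : SphereSmooth f) (hg : SphereSmooth g) : SphereSmooth fun x => f x + g x :=
  ContDiffOn.add hf hg

theorem mul (hf : SphereSmooth f) (hg : SphereSmooth g) : SphereSmooth fun x => f x * g x :=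
  ContDiffOn.mul hf hg

theorem const (c : ℝ) : SphereSmooth fun _ => c := contDiffOn_const

theorem sum {ι : Type} (s : Finset ι) {F : ι → E3 → ℝ} (hF : ∀ i ∈ s, SphereSmooth (F i)) :
    SphereSmooth fun x => ∑ i ∈ s, F i x :=
  ContDiffOn.sum hF

theorem coord (k : Fin 3) : SphereSmooth fun x => x k := by
  have h : ContDiff ℝ ∞ fun x : E3 => x k := by fun_prop
  exact h.comp_contDiffOn contDiffOn_normalize

end SphereSmooth

section

variable {f g : E3 → ℝ} {x : E3}

/-- Ray-constant extensions see only values on the unit sphere, so identities known there, such as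
the field equations, may be differentiated. -/
theorem pd_congr (hx : ‖x‖ = 1) (h : ∀ y : E3, ‖y‖ = 1 → f y = g y) (k : Fin 3) :
    pd f x k = pd g x k := by
  unfold pd
  have : rayExt f =ᶠ[𝓝 x] rayExt g := by
    filter_upwards [isOpen_nonzero.mem_nhds (ne_zero_of_unit hx)] with y hy
    exact h _ (norm_normalize hy)
  rw [this.fderiv_eq]

theorem pd_add (hf : SphereSmooth f) (hg : SphereSmooth g) (hx : ‖x‖ = 1) (k : Fin 3) :
    pd (fun y => f y + g y) x k = pd f x k + pd g x k := by
  have h := ((hf.differentiableAt (ne_zero_of_unit hx)).hasFDerivAt.add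
    (hg.differentiableAt (ne_zero_of_unit hx)).hasFDerivAt).fderiv
  exact congrArg (fun L : E3 →L[ℝ] ℝ => L (EuclideanSpace.single k 1)) h

theorem pd_mul (hf : SphereSmooth f) (hg : SphereSmooth g) (hx : ‖x‖ = 1) (k : Fin 3) :
    pd (fun y => f y * g y) x k = f x * pd g x k + g x * pd f x k := by
  have h := ((hf.differentiableAt (ne_zero_of_unit hx)).hasFDerivAt.mul
    (hg.differentiableAt (ne_zero_of_unit hx)).hasFDerivAt).fderiv
  have h' := congrArg (fun L : E3 →L[ℝ] ℝ => L (EuclideanSpace.single k 1)) h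
  simp only [rayExt_of_unit _ hx] at h'
  exact h'

theorem pd_const (c : ℝ) (k : Fin 3) : pd (fun _ => c) x k = 0 := by
  have : rayExt (fun _ : E3 => c) = fun _ => c := rfl
  simp [pd, this]

theorem pd_const_mul (c : ℝ) (hf : SphereSmooth f) (hx : ‖x‖ = 1) (k : Fin 3) :
    pd (fun y => c * f y) x k = c * pd f x k := by
  rw [pd_mul (SphereSmooth.const c) hf hx, pd_const, mul_zero, add_zero]

theorem pd_sum {ι : Type} (s : Finset ι) {F : ι → E3 → ℝ} (hF : ∀ i ∈ s, SphereSmooth (F i))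
    (hx : ‖x‖ = 1) (k : Fin 3) :
    pd (fun y => ∑ i ∈ s, F i y) x k = ∑ i ∈ s, pd (F i) x k := by
  have h := (HasFDerivAt.fun_sum fun i hi =>
    ((hF i hi).differentiableAt (ne_zero_of_unit hx)).hasFDerivAt).fderiv
  have h' := congrArg (fun L : E3 →L[ℝ] ℝ => L (EuclideanSpace.single k 1)) h
  rw [sum_apply] at h'
  exact h'

/-- Euler's identity in degree zero: the extension is constant along the ray through `x`, so its
radial derivative vanishes. This is what makes `pd` tangential. -/
theorem sum_mul_fderiv_rayExt (hf : SphereSmooth f) (hx : x ≠ 0) :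
    ∑ k, x k * fderiv ℝ (rayExt f) x (EuclideanSpace.single k 1) = 0 := by
  have h1 : ∑ k, x k * fderiv ℝ (rayExt f) x (EuclideanSpace.single k 1)
      = fderiv ℝ (rayExt f) x x := by
    have h : ∑ k, x k • EuclideanSpace.single k (1 : ℝ) = x := by
      simpa using (EuclideanSpace.basisFun (Fin 3) ℝ).sum_repr x
    calc _ = fderiv ℝ (rayExt f) x (∑ k, x k • EuclideanSpace.single k (1 : ℝ)) := by
          simp only [map_sum, map_smul, smul_eq_mul]
      _ = _ := by rw [h]
  rw [h1]
  have hc : HasDerivAt (fun t : ℝ => x + t • x) x 0 := by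
    simpa using ((hasDerivAt_id (0 : ℝ)).smul_const x).const_add x
  have hd := (hf.differentiableAt hx).hasFDerivAt
  have h2 : HasDerivAt (fun t : ℝ => rayExt f (x + t • x)) (fderiv ℝ (rayExt f) x x) 0 := by
    have hd' : HasFDerivAt (rayExt f) (fderiv ℝ (rayExt f) x) (x + (0 : ℝ) • x) := by
      rwa [zero_smul, add_zero]
    exact HasFDerivAt.comp_hasDerivAt (l := rayExt f) (0 : ℝ) hd' hc
  have h3 : (fun t : ℝ => rayExt f (x + t • x)) =ᶠ[𝓝 0] fun _ => rayExt f x := by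
    filter_upwards [Ioi_mem_nhds (show (-1 : ℝ) < 0 by norm_num)] with t ht
    have : x + t • x = (1 + t) • x := by rw [add_smul, one_smul]
    rw [this, rayExt_smul f (by simp at ht; linarith)]
  exact (h2.congr_of_eventuallyEq h3.symm).unique (hasDerivAt_const _ _)

theorem sum_mul_pd (hf : SphereSmooth f) (hx : ‖x‖ = 1) : ∑ k, x k * pd f x k = 0 :=
  sum_mul_fderiv_rayExt hf (ne_zero_of_unit hx)

/-- The extension of a coordinate is y_l / ‖y‖, and the derivative of the norm at a unit vector is
the inner product with it. -/
theorem pd_coord (hx : ‖x‖ = 1) (l k : Fin 3) : pd (fun y => y l) x k = proj x k l := by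
  have h0 := ne_zero_of_unit hx
  have h1 : HasFDerivAt (fun y : E3 => ‖y‖) (fderiv ℝ (fun y : E3 => ‖y‖) x) x :=
    ((contDiffAt_norm ℝ h0 (n := 1)).differentiableAt (by simp)).hasFDerivAt
  have hn : ∀ v, fderiv ℝ (fun y : E3 => ‖y‖) x v = inner ℝ x v := by
    intro v
    have h2 : HasFDerivAt (fun y : E3 => ‖y‖ ^ 2) (2 • innerSL ℝ x) x :=
      (hasStrictFDerivAt_norm_sq x).hasFDerivAt
    have h3 := congrArg (fun L : E3 →L[ℝ] ℝ => L v) (h2.unique (h1.pow 2))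
    simp [hx] at h3
    exact h3.symm
  have h2 : HasFDerivAt (fun y : E3 => y l) (EuclideanSpace.proj l : E3 →L[ℝ] ℝ) x :=
    (EuclideanSpace.proj l : E3 →L[ℝ] ℝ).hasFDerivAt
  have h3 : HasFDerivAt (fun y : E3 => ‖y‖⁻¹ * y l) _ x :=
    ((hasDerivAt_inv (norm_ne_zero_iff.2 h0)).comp_hasFDerivAt x h1).mul h2
  have h4 : rayExt (fun y : E3 => y l) = fun y => ‖y‖⁻¹ * y l := by
    ext y
    simp [rayExt]
  unfold pd
  rw [h4, h3.fderiv]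
  simp [hx, hn, proj, EuclideanSpace.inner_single_right]
  by_cases h : l = k
  · simp [h]
    ring
  · simp [h, Ne.symm h, mul_comm]

end
/-! ### Tensor algebra on the unit sphere -/

/-- Divergence of a tangential one-form with respect to the unit round metric. -/
noncomputable def sdiv (ξ : E3 → Fin 3 → ℝ) (x : E3) : ℝ := ∑ a, pd (fun y => ξ y a) x a

/-- Curl of a tangential one-form with respect to the unit round metric. -/
noncomputable def scurl (ξ : E3 → Fin 3 → ℝ) (x : E3) : ℝ :=
  ∑ a, ∑ b, vol x a b * pd (fun y => ξ y b) x a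

theorem sum_proj_mul {x : E3} {t : Fin 3 → ℝ} (ht : ∑ a, x a * t a = 0) (a : Fin 3) :
    ∑ l, proj x a l * t l = t a := by
  have h : ∑ l, proj x a l * t l = t a - x a * ∑ l, x l * t l := by
    simp [proj, sub_mul, Finset.sum_sub_distrib, Finset.mul_sum, mul_assoc]
  rw [h, ht, mul_zero, sub_zero]

theorem proj_comm (x : E3) (a b : Fin 3) : proj x a b = proj x b a := by
  simp [proj, eq_comm, mul_comm]

theorem vol_eq (x : E3) : vol x = ![![0, x 2, -x 1], ![-x 2, 0, x 0], ![x 1, -x 0, 0]] := by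
  ext a b
  fin_cases a <;> fin_cases b <;> simp [vol, Matrix.det_fin_three]

theorem vol_antisymm (x : E3) (a b : Fin 3) : vol x a b = -vol x b a := by
  rw [vol_eq]
  fin_cases a <;> fin_cases b <;> simp

theorem sum_mul_vol (x : E3) (a : Fin 3) : ∑ b, x b * vol x a b = 0 := by
  rw [vol_eq]
  fin_cases a <;> simp [Fin.sum_univ_three] <;> ring

theorem sum_vol_mul_proj (x : E3) (a c : Fin 3) : ∑ b, vol x a b * proj x b c = vol x a c := by
  rw [← sum_proj_mul (sum_mul_vol x a) c]
  exact Finset.sum_congr rfl fun b _ => by rw [proj_comm, mul_comm]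

section

variable {x : E3} {ξ : E3 → Fin 3 → ℝ} {X : E3 → Fin 3 → Fin 3 → ℝ} {f g : E3 → ℝ}

theorem grad_apply (hf : SphereSmooth f) (hx : ‖x‖ = 1) (a : Fin 3) : grad f x a = pd f x a :=
  sum_proj_mul (sum_mul_pd hf hx) a

/-- The projection on the derivative slot acts trivially, because `pd` is already tangential. -/
theorem cov1_apply (hξ : ∀ a, SphereSmooth fun y => ξ y a) (hx : ‖x‖ = 1) (a b : Fin 3) :
    cov1 ξ x a b = ∑ l, proj x b l * pd (fun y => ξ y l) x a := by
  unfold cov1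
  rw [Finset.sum_comm]
  refine Finset.sum_congr rfl fun l _ => ?_
  rw [← sum_proj_mul (sum_mul_pd (hξ l) hx) a, Finset.mul_sum]
  exact Finset.sum_congr rfl fun k _ => by ring

theorem cov2_apply (hX : ∀ a b, SphereSmooth fun y => X y a b) (hx : ‖x‖ = 1) (a b c : Fin 3) :
    cov2 X x a b c = ∑ l, ∑ m, proj x b l * proj x c m * pd (fun y => X y l m) x a := by
  unfold cov2
  rw [Finset.sum_comm]
  refine Finset.sum_congr rfl fun l _ => ?_
  rw [Finset.sum_comm]
  refine Finset.sum_congr rfl fun m _ => ?_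
  rw [← sum_proj_mul (sum_mul_pd (hX l m) hx) a, Finset.mul_sum]
  exact Finset.sum_congr rfl fun k _ => by ring

/-- Under the trace the remaining projection can be moved onto the derivative index, where it is
again trivial. -/
theorem sum_cov1_diag (hξ : ∀ a, SphereSmooth fun y => ξ y a) (hx : ‖x‖ = 1) :
    ∑ a, cov1 ξ x a a = sdiv ξ x := by
  simp only [cov1_apply hξ hx]
  rw [Finset.sum_comm]
  refine Finset.sum_congr rfl fun l _ => ?_
  rw [← sum_proj_mul (sum_mul_pd (hξ l) hx) l]
  exact Finset.sum_congr rfl fun k _ => by rw [proj_comm]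

theorem div1_eq (r : ℝ) (hξ : ∀ a, SphereSmooth fun y => ξ y a) (hx : ‖x‖ = 1) :
    div1 r ξ x = (r ^ 2)⁻¹ * sdiv ξ x := by
  rw [div1, sum_cov1_diag hξ hx]

theorem curl_eq {r : ℝ} (hr : r ≠ 0) (hξ : ∀ a, SphereSmooth fun y => ξ y a) (hx : ‖x‖ = 1) :
    curl r ξ x = (r ^ 2)⁻¹ * scurl ξ x := by
  have h : ∑ a, ∑ b, (r ^ 2 * vol x a b) * cov1 ξ x a b = r ^ 2 * scurl ξ x := by
    unfold scurl
    rw [Finset.mul_sum]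
    refine Finset.sum_congr rfl fun a _ => ?_
    simp only [cov1_apply hξ hx, Finset.mul_sum]
    rw [Finset.sum_comm]
    refine Finset.sum_congr rfl fun l _ => ?_
    rw [← sum_vol_mul_proj x a l, Finset.sum_mul, Finset.mul_sum]
    exact Finset.sum_congr rfl fun b _ => by ring
  rw [curl, h]
  field_simp

/-- The projection on the traced slot is absorbed by the derivative, and the one on the free slot by
the tangential vector `t`. -/
theorem sum_mul_div2 (r : ℝ) (hX : ∀ a b, SphereSmooth fun y => X y a b) (hx : ‖x‖ = 1)
    {t : Fin 3 → ℝ} (ht : ∑ a, x a * t a = 0) :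
    ∑ b, t b * div2 r X x b = (r ^ 2)⁻¹ * ∑ b, t b * ∑ a, pd (fun y => X y a b) x a := by
  have h1 : ∀ c, ∑ a, cov2 X x a a c = ∑ m, proj x c m * ∑ a, pd (fun y => X y a m) x a := by
    intro c
    simp only [cov2_apply hX hx, Finset.mul_sum]
    rw [Finset.sum_comm]
    rw [Finset.sum_congr rfl fun l _ => Finset.sum_comm, Finset.sum_comm]
    refine Finset.sum_congr rfl fun m _ => Finset.sum_congr rfl fun l _ => ?_
    rw [← sum_proj_mul (sum_mul_pd (hX l m) hx) l, Finset.mul_sum]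
    exact Finset.sum_congr rfl fun a _ => by rw [proj_comm x l a]; ring
  simp only [div2, h1]
  have h2 : ∀ m, t m = ∑ c, t c * proj x c m := fun m => by
    conv_lhs => rw [← sum_proj_mul ht m]
    exact Finset.sum_congr rfl fun c _ => by rw [proj_comm, mul_comm]
  conv_rhs => rw [Finset.mul_sum, Finset.sum_congr rfl fun m _ => by rw [h2 m]]
  simp only [Finset.mul_sum, Finset.sum_mul]
  rw [Finset.sum_comm]
  refine Finset.sum_congr rfl fun m _ => ?_
  rw [Finset.sum_comm]
  exact Finset.sum_congr rfl fun m _ => Finset.sum_congr rfl fun l _ => by ring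

/-- A symmetric traceless tangential tensor sees neither the antisymmetric part of the covariant
derivative nor the multiple of the metric subtracted in `D2star`; its tangentiality removes the
projections. -/
theorem sum_mul_D2star (r : ℝ) (hξ : ∀ a, SphereSmooth fun y => ξ y a)
    (hx : ‖x‖ = 1) {T : Fin 3 → Fin 3 → ℝ} (hT : ∀ b, ∑ a, x a * T a b = 0)
    (hs : ∀ a b, T a b = T b a) (htr : ∑ a, T a a = 0) :
    ∑ a, ∑ b, T a b * D2star r ξ x a b = -∑ a, ∑ b, T a b * pd (fun y => ξ y b) x a := by
  have hT' : ∀ a, ∑ b, x b * T a b = 0 := fun a => by simpa only [hs a] using hT a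
  have h1 : ∑ a, ∑ b, T a b * cov1 ξ x a b = ∑ a, ∑ b, T a b * pd (fun y => ξ y b) x a := by
    refine Finset.sum_congr rfl fun a _ => ?_
    simp only [cov1_apply hξ hx, Finset.mul_sum]
    rw [Finset.sum_comm]
    refine Finset.sum_congr rfl fun l _ => ?_
    conv_rhs => rw [← sum_proj_mul (hT' a) l, Finset.sum_mul]
    exact Finset.sum_congr rfl fun b _ => by rw [proj_comm]; ring
  have h2 : ∑ a, ∑ b, T a b * cov1 ξ x b a = ∑ a, ∑ b, T a b * cov1 ξ x a b := by
    rw [Finset.sum_comm]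
    simp only [hs]
  have h3 : ∑ a, ∑ b, T a b * proj x a b = 0 := by
    rw [← htr]
    refine Finset.sum_congr rfl fun a _ => ?_
    rw [← sum_proj_mul (hT' a) a]
    exact Finset.sum_congr rfl fun b _ => mul_comm _ _
  have h4 : ∑ a, ∑ b, T a b * D2star r ξ x a b
      = -(1 / 2) * (∑ a, ∑ b, T a b * cov1 ξ x a b + ∑ a, ∑ b, T a b * cov1 ξ x b a
        - div1 r ξ x * r ^ 2 * ∑ a, ∑ b, T a b * proj x a b) := by
    simp only [D2star, Finset.mul_sum, ← Finset.sum_add_distrib, ← Finset.sum_sub_distrib]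
    exact Finset.sum_congr rfl fun a _ => Finset.sum_congr rfl fun b _ => by ring
  rw [h4, h2, h1, h3]
  ring

theorem sum_mul_D1star {r : ℝ} (hr : r ≠ 0) (hf : SphereSmooth f) (hg : SphereSmooth g)
    (hx : ‖x‖ = 1) (t : Fin 3 → ℝ) :
    ∑ a, t a * D1star r f g x a
      = -∑ a, t a * pd f x a + ∑ a, ∑ b, t a * vol x a b * pd g x b := by
  simp only [D1star, grad_apply hf hx, grad_apply hg hx]
  rw [← Finset.sum_neg_distrib, ← Finset.sum_add_distrib]
  refine Finset.sum_congr rfl fun a _ => ?_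
  rw [mul_add, mul_neg, Finset.mul_sum]
  congr 1
  refine Finset.sum_congr rfl fun b _ => ?_
  field_simp

theorem sdiv_smul (hg : SphereSmooth g) (hξ : ∀ a, SphereSmooth fun y => ξ y a) (hx : ‖x‖ = 1) :
    sdiv (fun y a => g y * ξ y a) x = g x * sdiv ξ x + ∑ a, ξ x a * pd g x a := by
  simp only [sdiv, pd_mul hg (hξ _) hx, Finset.sum_add_distrib, Finset.mul_sum]

theorem sdiv_contract (hX : ∀ a b, SphereSmooth fun y => X y a b)
    (hξ : ∀ a, SphereSmooth fun y => ξ y a) (hx : ‖x‖ = 1) :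
    sdiv (fun y a => ∑ b, X y a b * ξ y b) x
      = ∑ b, ξ x b * ∑ a, pd (fun y => X y a b) x a
        + ∑ a, ∑ b, X x a b * pd (fun y => ξ y b) x a := by
  simp only [sdiv]
  simp only [pd_sum _ (fun b _ => (hX _ b).mul (hξ b)) hx, pd_mul (hX _ _) (hξ _) hx,
    Finset.sum_add_distrib, Finset.mul_sum]
  rw [add_comm, Finset.sum_comm]

/-- The volume form is divergence free: its components are linear in the position, with
antisymmetric coefficients, and differentiating the position gives the symmetric `proj`. -/
theorem pd_vol_contract (hx : ‖x‖ = 1) (a : Fin 3) :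
    ∑ b, pd (fun y => vol y b a) x b = 0 := by
  have h : ∀ l k : Fin 3, pd (fun y => -y l) x k = -proj x k l := fun l k => by
    have := pd_const_mul (-1) (SphereSmooth.coord l) hx k
    simpa [pd_coord hx] using this
  simp only [vol_eq, Fin.sum_univ_three]
  fin_cases a <;> simp [h, pd_coord hx, pd_const, proj] <;> ring

theorem sphereSmooth_vol (a b : Fin 3) : SphereSmooth fun y => vol y a b := by
  have h : ∀ l : Fin 3, SphereSmooth fun y => -y l := fun l => by
    simpa using (SphereSmooth.const (-1)).mul (SphereSmooth.coord l)
  simp only [vol_eq]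
  fin_cases a <;> fin_cases b <;>
    first | exact SphereSmooth.const 0 | exact SphereSmooth.coord _ | exact h _

theorem sdiv_rotate (hg : SphereSmooth g) (hξ : ∀ a, SphereSmooth fun y => ξ y a)
    (hx : ‖x‖ = 1) :
    sdiv (fun y b => g y * ∑ a, vol y b a * ξ y a) x
      = g x * scurl ξ x - ∑ a, ∑ b, ξ x a * vol x a b * pd g x b := by
  rw [sdiv_smul hg (fun b => SphereSmooth.sum _ fun a _ => (sphereSmooth_vol b a).mul (hξ a)) hx,
    sdiv_contract sphereSmooth_vol hξ hx]
  simp only [pd_vol_contract hx, mul_zero, Finset.sum_const_zero, zero_add, scurl, sub_eq_add_neg]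
  congr 1
  rw [← Finset.sum_neg_distrib]
  simp only [Finset.sum_mul]
  rw [Finset.sum_comm]
  refine Finset.sum_congr rfl fun a _ => ?_
  rw [← Finset.sum_neg_distrib]
  refine Finset.sum_congr rfl fun b _ => ?_
  rw [vol_antisymm x b a]
  ring
end
/-! ### The divergence theorem on the unit sphere -/

/-- Polar coordinates split the integral into an angular and a radial factor. The constant is fixed
before `g`, so it can be tested on g = 1 and used for another function. -/
theorem exists_integral_polar (ψ : ℝ → ℝ) : ∃ C : ℝ, ∀ g : E3 → ℝ,
    ∫ x : E3, g (‖x‖⁻¹ • x) * ψ ‖x‖ = sphereIntegral g * C := by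
  refine ⟨∫ t : Set.Ioi (0 : ℝ), ψ t ∂(Measure.volumeIoiPow (Module.finrank ℝ E3 - 1)),
    fun g => ?_⟩
  calc
    ∫ x : E3, g (‖x‖⁻¹ • x) * ψ ‖x‖
      = ∫ x : ({(0 : E3)}ᶜ : Set E3), g (‖x.1‖⁻¹ • x.1) * ψ ‖x.1‖
          ∂((volume : Measure E3).comap (↑)) := by
      rw [integral_subtype_comap (measurableSet_singleton _).compl
        fun x : E3 => g (‖x‖⁻¹ • x) * ψ ‖x‖, restrict_compl_singleton]
    _ = ∫ p : Metric.sphere (0 : E3) 1 × Set.Ioi (0 : ℝ), g p.1 * ψ p.2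
          ∂((volume : Measure E3).toSphere.prod
            (Measure.volumeIoiPow (Module.finrank ℝ E3 - 1))) := by
      simpa using ((volume : Measure E3).measurePreserving_homeomorphUnitSphereProd).integral_comp
        (Homeomorph.measurableEmbedding _)
        (fun p : Metric.sphere (0 : E3) 1 × Set.Ioi (0 : ℝ) => g p.1 * ψ p.2)
    _ = _ := integral_prod_mul (fun x : Metric.sphere (0 : E3) 1 => g x)
        (fun t : Set.Ioi (0 : ℝ) => ψ t)

theorem fderiv_rayExt_normalize {f : E3 → ℝ} (hf : SphereSmooth f) {x : E3} (hx : x ≠ 0)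
    (k : Fin 3) :
    fderiv ℝ (rayExt f) x (EuclideanSpace.single k 1) = ‖x‖⁻¹ * pd f (‖x‖⁻¹ • x) k := by
  have hn : 0 < ‖x‖⁻¹ := inv_pos.2 (norm_pos_iff.2 hx)
  have h1 : HasFDerivAt (rayExt f) (fderiv ℝ (rayExt f) (‖x‖⁻¹ • x)) (‖x‖⁻¹ • x) :=
    (hf.differentiableAt (ne_zero_of_unit (norm_normalize hx))).hasFDerivAt
  have h2 : HasFDerivAt (fun y : E3 => ‖x‖⁻¹ • y) (‖x‖⁻¹ • ContinuousLinearMap.id ℝ E3) x :=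
    HasFDerivAt.const_smul (hasFDerivAt_id x) ‖x‖⁻¹
  have h3 := HasFDerivAt.comp (f := fun y : E3 => ‖x‖⁻¹ • y) x h1 h2
  have h4 : rayExt f ∘ (fun y : E3 => ‖x‖⁻¹ • y) = rayExt f := by
    ext y
    exact rayExt_smul f hn y
  rw [h4] at h3
  rw [h3.fderiv]
  simp [pd]

/-- The Euclidean field φ(‖x‖²) ξ(x/‖x‖) has compact support away from the origin, so its divergence
has integral zero over ℝ³. Since ξ is tangential, the gradient of the radial cutoff does not
contribute, and the divergence is a radial function times the spherical one. Polar coordinates then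
give the claim, as the radial integral is nonzero. -/
theorem sphereIntegral_sdiv {ξ : E3 → Fin 3 → ℝ} (hξ : ∀ a, SphereSmooth fun y => ξ y a)
    (ht : ∀ x : E3, ‖x‖ = 1 → ∑ a, x a * ξ x a = 0) :
    sphereIntegral (sdiv ξ) = 0 := by
  -- As a function of ‖x‖², this bump vanishes outside the interval from 1 to 3, which keeps the
  -- singularity of `rayExt` at the origin and infinity out of the support.
  let φ : ContDiffBump (2 : ℝ) := ⟨1 / 2, 1, by norm_num, by norm_num⟩
  have hφ0 : ∀ t : ℝ, t ≤ 1 ∨ 3 ≤ t → φ t = 0 := by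
    intro t h
    refine φ.zero_of_le_dist ?_
    rw [Real.dist_eq, le_abs]
    rcases h with h | h
    · right; show (1 : ℝ) ≤ _; linarith
    · left; show (1 : ℝ) ≤ _; linarith
  have hlocal : ∀ᶠ x : E3 in 𝓝 0, φ (‖x‖ ^ 2) = 0 := by
    filter_upwards [Metric.ball_mem_nhds (0 : E3) one_pos] with x hx
    rw [mem_ball_zero_iff] at hx
    exact hφ0 _ (Or.inl (by nlinarith [norm_nonneg x]))
  have hfar : ∀ x : E3, x ∉ Metric.closedBall (0 : E3) 2 → φ (‖x‖ ^ 2) = 0 := by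
    intro x hx
    rw [mem_closedBall_zero_iff, not_le] at hx
    exact hφ0 _ (Or.inr (by nlinarith))
  have hφs : ContDiff ℝ ∞ fun x : E3 => φ (‖x‖ ^ 2) := φ.contDiff.comp (contDiff_norm_sq ℝ)
  let V : Fin 3 → E3 → ℝ := fun k x => φ (‖x‖ ^ 2) * rayExt (fun y => ξ y k) x
  have hV : ∀ k, ContDiff ℝ ∞ (V k) := by
    intro k
    rw [contDiff_iff_contDiffAt]
    intro x
    by_cases hx : x = 0
    · subst hx
      refine (contDiffAt_const (c := (0 : ℝ))).congr_of_eventuallyEq ?_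
      filter_upwards [hlocal] with x hx
      simp [V, hx]
    · exact hφs.contDiffAt.mul ((hξ k).contDiffAt hx)
  have hVc : ∀ k, HasCompactSupport (V k) := fun k =>
    HasCompactSupport.intro (isCompact_closedBall (0 : E3) 2) fun x hx => by simp [V, hfar x hx]
  have hint : ∀ k, Integrable (fun x => fderiv ℝ (V k) x (EuclideanSpace.single k 1)) := fun k =>
    (((hV k).continuous_fderiv (by simp)).clm_apply continuous_const).integrable_of_hasCompactSupport
      ((hVc k).fderiv_apply ℝ _)
  have hzero : ∀ k, ∫ x, fderiv ℝ (V k) x (EuclideanSpace.single k 1) = 0 := by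
    intro k
    -- Integration by parts against the constant function 1.
    have h := integral_mul_fderiv_eq_neg_fderiv_mul_of_integrable (μ := (volume : Measure E3))
      (f := fun _ => (1 : ℝ)) (g := V k) (v := EuclideanSpace.single k 1) (by simp)
      (by simpa using hint k)
      (by simpa using (hV k).continuous.integrable_of_hasCompactSupport (hVc k))
      (fun _ _ => differentiableAt_const _)
      (fun x _ => ((hV k).differentiable (by simp)) x)
    simpa using h
  have hpoint : ∀ x : E3, ∑ k, fderiv ℝ (V k) x (EuclideanSpace.single k 1)
      = sdiv ξ (‖x‖⁻¹ • x) * (φ (‖x‖ ^ 2) * ‖x‖⁻¹) := by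
    intro x
    by_cases hx : x = 0
    · subst hx
      have : ∀ k, fderiv ℝ (V k) 0 = 0 := fun k => by
        have : V k =ᶠ[𝓝 0] fun _ => 0 := by
          filter_upwards [hlocal] with x hx
          simp [V, hx]
        rw [this.fderiv_eq]
        simp
      simp [this]
    · have hd : ∀ k, fderiv ℝ (V k) x (EuclideanSpace.single k 1)
          = φ (‖x‖ ^ 2) * (‖x‖⁻¹ * pd (fun y => ξ y k) (‖x‖⁻¹ • x) k)
            + (2 * deriv φ (‖x‖ ^ 2) * ‖x‖) * ((‖x‖⁻¹ • x) k * ξ (‖x‖⁻¹ • x) k) := by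
        intro k
        have h1 : HasFDerivAt (fun x : E3 => φ (‖x‖ ^ 2)) (deriv φ (‖x‖ ^ 2) • (2 • innerSL ℝ x)) x :=
          ((φ.contDiff (n := 1)).differentiable (by simp) _).hasDerivAt.comp_hasFDerivAt x
            (hasStrictFDerivAt_norm_sq x).hasFDerivAt
        have h2 := (h1.mul ((hξ k).differentiableAt hx).hasFDerivAt).fderiv
        have h3 := congrArg (fun L : E3 →L[ℝ] ℝ => L (EuclideanSpace.single k 1)) h2
        refine h3.trans ?_
        have hn := norm_ne_zero_iff.2 hx
        simp [fderiv_rayExt_normalize (hξ k) hx, rayExt, EuclideanSpace.inner_single_right]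
        field_simp
      -- The derivative of the cutoff multiplies the normal component of ξ, which is zero.
      rw [Finset.sum_congr rfl fun k _ => hd k, Finset.sum_add_distrib, ← Finset.mul_sum,
        ← Finset.mul_sum, ← Finset.mul_sum, ht _ (norm_normalize hx)]
      simp only [sdiv]
      ring
  obtain ⟨C, hC⟩ := exists_integral_polar fun t => φ (t ^ 2) * t⁻¹
  have h0 : sphereIntegral (sdiv ξ) * C = 0 := by
    rw [← hC, ← integral_congr_ae (ae_of_all _ hpoint), integral_finsetSum _ fun k _ => hint k]
    simp [hzero]
  -- With g = 1, vanishing of `C` would force the integral of a continuous nonnegative function to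
  -- vanish, although it is positive at a point with ‖x‖² = 2, the centre of the bump.
  have hC0 : C ≠ 0 := by
    intro h
    have h1 := hC fun _ => 1
    rw [h, mul_zero] at h1
    simp only [one_mul] at h1
    have hcont : Continuous fun x : E3 => φ (‖x‖ ^ 2) * ‖x‖⁻¹ := by
      rw [continuous_iff_continuousAt]
      intro x
      by_cases hx : x = 0
      · subst hx
        refine (continuousAt_const (y := (0 : ℝ))).congr ?_
        filter_upwards [hlocal] with x hx
        simp [hx]
      · exact hφs.continuous.continuousAt.mul
          (continuous_norm.continuousAt.inv₀ (norm_ne_zero_iff.2 hx))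
    have hcs : HasCompactSupport fun x : E3 => φ (‖x‖ ^ 2) * ‖x‖⁻¹ :=
      HasCompactSupport.intro (isCompact_closedBall (0 : E3) 2) fun x hx => by simp [hfar x hx]
    have hpos := hcont.integral_pos_of_hasCompactSupport_nonneg_nonzero (μ := (volume : Measure E3))
      (x := EuclideanSpace.single 0 (Real.sqrt 2)) hcs
      (fun x => mul_nonneg φ.nonneg (inv_nonneg.2 (norm_nonneg x))) (by
        have : φ (2 : ℝ) = 1 := φ.one_of_mem_closedBall (Metric.mem_closedBall_self (by norm_num))
        simp [this])
    exact hpos.ne' h1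
  exact (mul_eq_zero.1 h0).resolve_right hC0

/-! ### The area radius -/

namespace RN

variable (bg : RN)

/-- The area radius as a function of the tortoise coordinate. -/
noncomputable def radT (t : ℝ) : ℝ := Classical.choose (bg.exists_radius t)

theorem radT_gt (t : ℝ) : bg.rPlus < bg.radT t := (Classical.choose_spec (bg.exists_radius t)).1

theorem radT_pos (t : ℝ) : 0 < bg.radT t := bg.rPlus_pos.trans (bg.radT_gt t)

theorem tortoise_radT (t : ℝ) : bg.tortoise (bg.radT t) = t :=
  (Classical.choose_spec (bg.exists_radius t)).2

theorem tortoise_strictMonoOn : StrictMonoOn bg.tortoise (Set.Ioi bg.rPlus) := by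
  refine strictMonoOn_of_deriv_pos (convex_Ioi _)
    (fun r hr => (bg.tortoise_hasDerivAt hr).continuousAt.continuousWithinAt) fun r hr => ?_
  rw [interior_Ioi] at hr
  rw [(bg.tortoise_hasDerivAt hr).deriv]
  exact inv_pos.2 (bg.D_bounds hr).1

theorem radT_strictMono : StrictMono bg.radT := by
  intro s t hst
  by_contra h
  have := bg.tortoise_strictMonoOn.monotoneOn (bg.radT_gt t) (bg.radT_gt s) (not_lt.1 h)
  rw [tortoise_radT, tortoise_radT] at this
  linarith

theorem radT_tortoise {r : ℝ} (hr : bg.rPlus < r) : bg.radT (bg.tortoise r) = r :=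
  bg.tortoise_strictMonoOn.injOn (bg.radT_gt _) hr (bg.tortoise_radT _)

/-- A monotone function whose image is a neighbourhood of its value is continuous; here every radius
beyond the horizon is attained. -/
theorem radT_continuousAt (t : ℝ) : ContinuousAt bg.radT t := by
  refine continuousAt_of_monotoneOn_of_image_mem_nhds (s := Set.univ)
    (bg.radT_strictMono.monotone.monotoneOn _) univ_mem ?_
  refine mem_of_superset (Ioi_mem_nhds (bg.radT_gt t)) fun r hr => ?_
  exact ⟨_, Set.mem_univ _, bg.radT_tortoise hr⟩

theorem radT_hasDerivAt (t : ℝ) : HasDerivAt bg.radT (bg.D (bg.radT t)) t := by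
  have h := HasDerivAt.of_local_left_inverse (bg.radT_continuousAt t)
    (bg.tortoise_hasDerivAt (bg.radT_gt t)) (inv_ne_zero (bg.D_bounds (bg.radT_gt t)).1.ne')
    (Eventually.of_forall bg.tortoise_radT)
  rwa [inv_inv] at h

/-- Bootstrapping in the equation r' = D(r): its right side is as regular as r, so each step gains
one derivative. -/
theorem radT_contDiff : ContDiff ℝ ∞ bg.radT := by
  rw [contDiff_infty]
  intro n
  induction n with
  | zero => exact contDiff_zero.2 (continuous_iff_continuousAt.2 bg.radT_continuousAt)
  | succ n ih =>
    push_cast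
    rw [contDiff_succ_iff_deriv]
    refine ⟨fun t => (bg.radT_hasDerivAt t).differentiableAt, by simp, ?_⟩
    have : deriv bg.radT = fun t => 1 - 2 * bg.M / bg.radT t + bg.Q ^ 2 / bg.radT t ^ 2 := by
      ext t
      exact (bg.radT_hasDerivAt t).deriv
    rw [this]
    exact (contDiff_const.sub (contDiff_const.div ih fun t => (bg.radT_pos t).ne')).add
      (contDiff_const.div (ih.pow 2) fun t => pow_ne_zero 2 (bg.radT_pos t).ne')

theorem rad_pos (u v : ℝ) : 0 < bg.rad u v := bg.radT_pos _

theorem rad_contDiff : ContDiff ℝ ∞ fun p : ℝ × ℝ => bg.rad p.1 p.2 :=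
  bg.radT_contDiff.comp (contDiff_snd.sub contDiff_fst)

theorem D_rad_pos (u v : ℝ) : 0 < bg.D (bg.rad u v) := (bg.D_bounds (bg.rad_gt u v)).1

theorem Om_pos (u v : ℝ) : 0 < bg.Om u v := Real.sqrt_pos.2 (bg.D_rad_pos u v)

theorem Om_sq (u v : ℝ) : bg.Om u v ^ 2 = bg.D (bg.rad u v) := Real.sq_sqrt (bg.D_rad_pos u v).le

theorem Om_contDiff : ContDiff ℝ ∞ fun p : ℝ × ℝ => bg.Om p.1 p.2 := by
  have h : ContDiff ℝ ∞ fun p : ℝ × ℝ => bg.D (bg.rad p.1 p.2) :=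
    (contDiff_const.sub (contDiff_const.div bg.rad_contDiff fun p => (bg.rad_pos _ _).ne')).add
      (contDiff_const.div (bg.rad_contDiff.pow 2) fun p => pow_ne_zero 2 (bg.rad_pos _ _).ne')
  exact h.sqrt fun p => (bg.D_rad_pos _ _).ne'

theorem rad_hasDerivAt_u (u v : ℝ) :
    HasDerivAt (fun s => bg.rad s v) (-bg.Om u v ^ 2) u := by
  have h := (bg.radT_hasDerivAt (v - u)).comp u ((hasDerivAt_id u).const_sub v)
  rw [bg.Om_sq]
  exact h.congr_deriv (mul_neg_one _)

theorem rad_hasDerivAt_v (u v : ℝ) :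
    HasDerivAt (fun s => bg.rad u s) (bg.Om u v ^ 2) v := by
  have h := (bg.radT_hasDerivAt (v - u)).comp v ((hasDerivAt_id v).sub_const u)
  rw [bg.Om_sq]
  exact h.congr_deriv (mul_one _)

/-- Here `ρ` is a curve of radii, not a curvature component. The formula is the chain rule with D' =
2ω, stated for a curve so as to serve both null directions. -/
theorem Om_hasDerivAt_of_rad {ρ : ℝ → ℝ} {ρ' s u v : ℝ} (h : HasDerivAt ρ ρ' s)
    (hs : ρ s = bg.rad u v) :
    HasDerivAt (fun s => Real.sqrt (bg.D (ρ s))) (bg.om u v * ρ' / bg.Om u v) s := by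
  have hr := bg.rad_pos u v
  have hO := bg.Om_pos u v
  have h1 : HasDerivAt (fun s => bg.D (ρ s)) (2 * bg.om u v * ρ') s := by
    have h2 := ((h.inv (by rw [hs]; exact hr.ne')).const_mul (2 * bg.M)).const_sub 1
    have h3 := ((h.pow 2).inv (by simp [hs, hr.ne'])).const_mul (bg.Q ^ 2)
    refine (h2.add h3).congr_deriv ?_
    simp only [hs, om, Pi.pow_apply]
    field_simp
    ring
  refine (h1.sqrt (by rw [hs]; exact (bg.D_rad_pos u v).ne')).congr_deriv ?_
  rw [hs]
  change 2 * bg.om u v * ρ' / (2 * bg.Om u v) = _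
  field_simp

theorem Om_hasDerivAt_u (u v : ℝ) :
    HasDerivAt (fun s => bg.Om s v) (-(bg.om u v * bg.Om u v)) u := by
  refine (bg.Om_hasDerivAt_of_rad (bg.rad_hasDerivAt_u u v) rfl).congr_deriv ?_
  have hO := bg.Om_pos u v
  field_simp

theorem Om_hasDerivAt_v (u v : ℝ) :
    HasDerivAt (fun s => bg.Om u s) (bg.om u v * bg.Om u v) v := by
  refine (bg.Om_hasDerivAt_of_rad (bg.rad_hasDerivAt_v u v) rfl).congr_deriv ?_
  have hO := bg.Om_pos u v
  field_simp

end RN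

/-! ### Smooth fields -/

/-- The ray-constant extension of a field. -/
noncomputable def fieldExt {V : Type} (F : Field V) (p : ℝ × ℝ × E3) : V :=
  rayExt (F p.1 p.2.1) p.2.2

theorem isOpen_fieldDomain : IsOpen {p : ℝ × ℝ × E3 | p.2.2 ≠ 0} :=
  isOpen_ne.preimage (continuous_snd.comp continuous_snd)

namespace SmoothField

section closure

variable {F G : Scal}

theorem add (hF : SmoothField F) (hG : SmoothField G) :
    SmoothField fun u v x => F u v x + G u v x := ContDiffOn.add hF hG

theorem mul (hF : SmoothField F) (hG : SmoothField G) :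
    SmoothField fun u v x => F u v x * G u v x := ContDiffOn.mul hF hG

theorem pow (hF : SmoothField F) (n : ℕ) :
    SmoothField fun u v x => F u v x ^ n := ContDiffOn.pow hF n

theorem sum {ι : Type} (s : Finset ι) {H : ι → Scal} (hH : ∀ i ∈ s, SmoothField (H i)) :
    SmoothField fun u v x => ∑ i ∈ s, H i u v x :=
  ContDiffOn.sum (f := fun i => fieldExt (H i)) hH

theorem of_contDiff {a : ℝ → ℝ → ℝ} (ha : ContDiff ℝ ∞ fun p : ℝ × ℝ => a p.1 p.2) :
    SmoothField fun u v (_ : E3) => a u v := by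
  have : ContDiff ℝ ∞ fun p : ℝ × ℝ × E3 => (p.1, p.2.1) := by fun_prop
  exact (ha.comp this).contDiffOn

theorem const (c : ℝ) : SmoothField fun _ _ (_ : E3) => c := contDiffOn_const

end closure

theorem contDiffAt {V : Type} [NormedAddCommGroup V] [NormedSpace ℝ V] {F : Field V}
    (hF : SmoothField F) {p : ℝ × ℝ × E3} (hp : p.2.2 ≠ 0) : ContDiffAt ℝ ∞ (fieldExt F) p :=
  ContDiffOn.contDiffAt hF (isOpen_fieldDomain.mem_nhds hp)

theorem comp1 {F : OneForm} (hF : SmoothField F) (a : Fin 3) :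
    SmoothField fun u v x => F u v x a := (contDiffOn_pi.1 hF) a

theorem comp2 {F : Tens2} (hF : SmoothField F) (a b : Fin 3) :
    SmoothField fun u v x => F u v x a b := (contDiffOn_pi.1 ((contDiffOn_pi.1 hF) a)) b

theorem sphereSmooth {F : Scal} (hF : SmoothField F) (u v : ℝ) : SphereSmooth (F u v) := by
  have h : ContDiff ℝ ∞ fun x : E3 => (u, v, x) := by fun_prop
  exact ContDiffOn.comp (t := {p : ℝ × ℝ × E3 | p.2.2 ≠ 0}) hF h.contDiffOn fun _ hx => hx

theorem continuous {F : Scal} (hF : SmoothField F) :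
    Continuous fun p : ℝ × ℝ × Metric.sphere (0 : E3) 1 => F p.1 p.2.1 p.2.2 := by
  have hu : ∀ x : Metric.sphere (0 : E3) 1, ‖(x : E3)‖ = 1 := fun x => by simp
  have h : Continuous fun p : ℝ × ℝ × Metric.sphere (0 : E3) 1 =>
      fieldExt F (p.1, p.2.1, (p.2.2 : E3)) :=
    ContinuousOn.comp_continuous (s := {p : ℝ × ℝ × E3 | p.2.2 ≠ 0}) (ContDiffOn.continuousOn hF)
      (by fun_prop) fun p => ne_zero_of_unit (hu _)
  refine h.congr fun p => ?_
  exact rayExt_of_unit _ (hu _)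

/-! ### Null derivatives of smooth fields -/

section derivatives

variable {V : Type} [NormedAddCommGroup V] [NormedSpace ℝ V] {F : Field V}

theorem hasFDerivAt (hF : SmoothField F) {p : ℝ × ℝ × E3} (hp : p.2.2 ≠ 0) :
    HasFDerivAt (fieldExt F) (fderiv ℝ (fieldExt F) p) p :=
  ((hF.contDiffAt hp).differentiableAt (by simp)).hasFDerivAt

theorem hasDerivAt_u_fderiv (hF : SmoothField F) (u v : ℝ) {x : E3} (hx : x ≠ 0) :
    HasDerivAt (fun s => fieldExt F (s, v, x)) (fderiv ℝ (fieldExt F) (u, v, x) (1, 0, 0)) u := by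
  have h : HasDerivAt (fun s : ℝ => (s, v, x)) ((1 : ℝ), (0 : ℝ), (0 : E3)) u :=
    (hasDerivAt_id u).prodMk (hasDerivAt_const u (v, x))
  exact HasFDerivAt.comp_hasDerivAt (l := fieldExt F) u (hF.hasFDerivAt hx) h

theorem hasDerivAt_v_fderiv (hF : SmoothField F) (u v : ℝ) {x : E3} (hx : x ≠ 0) :
    HasDerivAt (fun s => fieldExt F (u, s, x)) (fderiv ℝ (fieldExt F) (u, v, x) (0, 1, 0)) v := by
  have h : HasDerivAt (fun s : ℝ => (u, s, x)) ((0 : ℝ), (1 : ℝ), (0 : E3)) v :=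
    (hasDerivAt_const v u).prodMk ((hasDerivAt_id v).prodMk (hasDerivAt_const v x))
  exact HasFDerivAt.comp_hasDerivAt (l := fieldExt F) v (hF.hasFDerivAt hx) h

theorem fieldExt_dU (hF : SmoothField F) {p : ℝ × ℝ × E3} (hp : p.2.2 ≠ 0) :
    fieldExt (dU F) p = fderiv ℝ (fieldExt F) p (1, 0, 0) :=
  (hF.hasDerivAt_u_fderiv p.1 p.2.1 hp).deriv

theorem fieldExt_dV (hF : SmoothField F) {p : ℝ × ℝ × E3} (hp : p.2.2 ≠ 0) :
    fieldExt (dV F) p = fderiv ℝ (fieldExt F) p (0, 1, 0) :=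
  (hF.hasDerivAt_v_fderiv p.1 p.2.1 hp).deriv

theorem contDiffOn_fderiv_apply (hF : SmoothField F) (e : ℝ × ℝ × E3) :
    ContDiffOn ℝ ∞ (fun p => fderiv ℝ (fieldExt F) p e) {p : ℝ × ℝ × E3 | p.2.2 ≠ 0} :=
  (ContDiffOn.fderiv_of_isOpen (m := ∞) (n := ∞) hF isOpen_fieldDomain (by simp)).clm_apply
    contDiffOn_const

theorem dU (hF : SmoothField F) : SmoothField (dU F) :=
  (hF.contDiffOn_fderiv_apply (1, 0, 0)).congr fun _ hp => hF.fieldExt_dU hp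

theorem dV (hF : SmoothField F) : SmoothField (dV F) :=
  (hF.contDiffOn_fderiv_apply (0, 1, 0)).congr fun _ hp => hF.fieldExt_dV hp

theorem hasDerivAt_u (hF : SmoothField F) (u v : ℝ) {x : E3} (hx : ‖x‖ = 1) :
    HasDerivAt (fun s => F s v x) (EMDN.dU F u v x) u := by
  have h := hF.hasDerivAt_u_fderiv u v (ne_zero_of_unit hx)
  rw [← hF.fieldExt_dU (p := (u, v, x)) (ne_zero_of_unit hx)] at h
  simpa only [fieldExt, rayExt_of_unit _ hx] using h

theorem hasDerivAt_v (hF : SmoothField F) (u v : ℝ) {x : E3} (hx : ‖x‖ = 1) :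
    HasDerivAt (fun s => F u s x) (EMDN.dV F u v x) v := by
  have h := hF.hasDerivAt_v_fderiv u v (ne_zero_of_unit hx)
  rw [← hF.fieldExt_dV (p := (u, v, x)) (ne_zero_of_unit hx)] at h
  simpa only [fieldExt, rayExt_of_unit _ hx] using h

end derivatives

/-! ### Angular derivatives and their commutation with the null derivatives -/

section angular

variable {F : Scal}

theorem fderiv_rayExt (hF : SmoothField F) (u v : ℝ) {x : E3} (hx : x ≠ 0) (k : Fin 3) :
    fderiv ℝ (rayExt (F u v)) x (EuclideanSpace.single k 1)
      = fderiv ℝ (fieldExt F) (u, v, x) (0, 0, EuclideanSpace.single k 1) := by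
  have h : HasFDerivAt (fun y : E3 => (u, v, y))
      ((0 : E3 →L[ℝ] ℝ).prod ((0 : E3 →L[ℝ] ℝ).prod (ContinuousLinearMap.id ℝ E3))) x :=
    (hasFDerivAt_const u x).prodMk ((hasFDerivAt_const v x).prodMk (hasFDerivAt_id x))
  have h2 := HasFDerivAt.comp (f := fun y : E3 => (u, v, y)) x
    (hF.hasFDerivAt (p := (u, v, x)) hx) h
  have h3 : fieldExt F ∘ (fun y : E3 => (u, v, y)) = rayExt (F u v) := rfl
  rw [h3] at h2
  rw [h2.fderiv]
  simp

theorem pd (hF : SmoothField F) (k : Fin 3) : SmoothField fun u v x => EMDN.pd (F u v) x k := by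
  have h : ContDiffOn ℝ ∞ (fun p : ℝ × ℝ × E3 => (p.1, p.2.1, ‖p.2.2‖⁻¹ • p.2.2))
      {p | p.2.2 ≠ 0} :=
    contDiff_fst.contDiffOn.prodMk ((contDiff_fst.comp contDiff_snd).contDiffOn.prodMk
      (contDiffOn_normalize.comp (contDiff_snd.comp contDiff_snd).contDiffOn fun _ hp => hp))
  refine ((hF.contDiffOn_fderiv_apply (0, 0, EuclideanSpace.single k 1)).comp h
    fun p hp => ne_zero_of_unit (norm_normalize hp)).congr fun p hp => ?_
  exact hF.fderiv_rayExt _ _ (ne_zero_of_unit (norm_normalize hp)) k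

theorem two_le_infty : (2 : WithTop ℕ∞) ≤ ∞ :=
  WithTop.coe_le_coe.2 (le_top : (2 : ℕ∞) ≤ ⊤)

theorem fderiv_fderiv_apply (hF : SmoothField F) {p : ℝ × ℝ × E3} (hp : p.2.2 ≠ 0)
    (e : ℝ × ℝ × E3) :
    HasFDerivAt (fun q => fderiv ℝ (fieldExt F) q e)
      ((ContinuousLinearMap.apply ℝ ℝ e).comp (fderiv ℝ (fderiv ℝ (fieldExt F)) p)) p := by
  have h : DifferentiableAt ℝ (fderiv ℝ (fieldExt F)) p :=
    ((hF.contDiffAt hp).fderiv_right (m := 1) (by norm_num; exact two_le_infty)).differentiableAt (by simp)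
  exact (ContinuousLinearMap.apply ℝ ℝ e).hasFDerivAt.comp p h.hasFDerivAt

/-- Symmetry of second derivatives of the extension. With `e` a null coordinate direction it makes
∂_u and ∂_v commute with angular derivatives. -/
theorem pd_fderiv_apply (hF : SmoothField F) (u v : ℝ) {x : E3} (hx : ‖x‖ = 1) (k : Fin 3)
    {H : E3 → ℝ} {e : ℝ × ℝ × E3}
    (hH : ∀ y : E3, y ≠ 0 → rayExt H y = fderiv ℝ (fieldExt F) (u, v, y) e) :
    EMDN.pd H x k = fderiv ℝ (fderiv ℝ (fieldExt F)) (u, v, x) e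
      (0, 0, EuclideanSpace.single k 1) := by
  have h0 := ne_zero_of_unit hx
  have h1 : rayExt H =ᶠ[𝓝 x] fun y => fderiv ℝ (fieldExt F) (u, v, y) e := by
    filter_upwards [isOpen_nonzero.mem_nhds h0] with y hy using hH y hy
  have h : HasFDerivAt (fun y : E3 => (u, v, y))
      ((0 : E3 →L[ℝ] ℝ).prod ((0 : E3 →L[ℝ] ℝ).prod (ContinuousLinearMap.id ℝ E3))) x :=
    (hasFDerivAt_const u x).prodMk ((hasFDerivAt_const v x).prodMk (hasFDerivAt_id x))
  have h2 := HasFDerivAt.comp (f := fun y : E3 => (u, v, y)) x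
    (hF.fderiv_fderiv_apply (p := (u, v, x)) h0 e) h
  have h3 : HasFDerivAt (fun y => fderiv ℝ (fieldExt F) (u, v, y) e) _ x := h2
  have hsymm := (hF.contDiffAt (p := (u, v, x)) h0).isSymmSndFDerivAt (by simpa using two_le_infty)
  rw [EMDN.pd, h1.fderiv_eq, h3.fderiv, hsymm.eq]
  simp

theorem pd_hasDerivAt_u (hF : SmoothField F) (u v : ℝ) {x : E3} (hx : ‖x‖ = 1) (k : Fin 3) :
    HasDerivAt (fun s => EMDN.pd (F s v) x k) (EMDN.pd (EMDN.dU F u v) x k) u := by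
  have h0 := ne_zero_of_unit hx
  have h : HasDerivAt (fun s : ℝ => (s, v, x)) ((1 : ℝ), (0 : ℝ), (0 : E3)) u :=
    (hasDerivAt_id u).prodMk (hasDerivAt_const u (v, x))
  have h1 := HasFDerivAt.comp_hasDerivAt u
    (hF.fderiv_fderiv_apply (p := (u, v, x)) h0 (0, 0, EuclideanSpace.single k 1)) h
  rw [hF.pd_fderiv_apply u v hx k (H := EMDN.dU F u v)
    fun y hy => hF.fieldExt_dU (p := (u, v, y)) hy]
  refine h1.congr_of_eventuallyEq (Eventually.of_forall fun s => ?_)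
  exact hF.fderiv_rayExt s v h0 k

theorem pd_hasDerivAt_v (hF : SmoothField F) (u v : ℝ) {x : E3} (hx : ‖x‖ = 1) (k : Fin 3) :
    HasDerivAt (fun s => EMDN.pd (F u s) x k) (EMDN.pd (EMDN.dV F u v) x k) v := by
  have h0 := ne_zero_of_unit hx
  have h : HasDerivAt (fun s : ℝ => (u, s, x)) ((0 : ℝ), (1 : ℝ), (0 : E3)) v :=
    (hasDerivAt_const v u).prodMk ((hasDerivAt_id v).prodMk (hasDerivAt_const v x))
  have h1 := HasFDerivAt.comp_hasDerivAt v
    (hF.fderiv_fderiv_apply (p := (u, v, x)) h0 (0, 0, EuclideanSpace.single k 1)) h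
  rw [hF.pd_fderiv_apply u v hx k (H := EMDN.dV F u v)
    fun y hy => hF.fieldExt_dV (p := (u, v, y)) hy]
  refine h1.congr_of_eventuallyEq (Eventually.of_forall fun s => ?_)
  exact hF.fderiv_rayExt u s h0 k

end angular

end SmoothField

/-! ### Functions that are divergences on the unit sphere -/

/-- `h` is, on the unit sphere, the divergence of a smooth tangential one-form. -/
def IsSphereDiv (h : E3 → ℝ) : Prop :=
  ∃ ξ : E3 → Fin 3 → ℝ, (∀ a, SphereSmooth fun y => ξ y a) ∧
    (∀ x : E3, ‖x‖ = 1 → ∑ a, x a * ξ x a = 0) ∧ ∀ x : E3, ‖x‖ = 1 → h x = sdiv ξ x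

namespace IsSphereDiv

variable {g h : E3 → ℝ}

theorem integral_eq_zero (hh : IsSphereDiv h) : sphereIntegral h = 0 := by
  obtain ⟨ξ, hs, ht, he⟩ := hh
  rw [← sphereIntegral_sdiv hs ht]
  unfold sphereIntegral
  congr 1
  ext x
  exact he x (by simp)

theorem add (hg : IsSphereDiv g) (hh : IsSphereDiv h) : IsSphereDiv fun x => g x + h x := by
  obtain ⟨ξ, hs, ht, he⟩ := hg
  obtain ⟨ζ, hs', ht', he'⟩ := hh
  refine ⟨fun y a => ξ y a + ζ y a, fun a => (hs a).add (hs' a), fun x hx => ?_, fun x hx => ?_⟩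
  · simp only [mul_add, Finset.sum_add_distrib, ht x hx, ht' x hx, add_zero]
  · simp only [he x hx, he' x hx, sdiv, pd_add (hs _) (hs' _) hx, Finset.sum_add_distrib]

theorem const_mul (c : ℝ) (hh : IsSphereDiv h) : IsSphereDiv fun x => c * h x := by
  obtain ⟨ξ, hs, ht, he⟩ := hh
  refine ⟨fun y a => c * ξ y a, fun a => (SphereSmooth.const c).mul (hs a), fun x hx => ?_,
    fun x hx => ?_⟩
  · simp only [mul_left_comm _ c, ← Finset.mul_sum, ht x hx, mul_zero]
  · simp only [he x hx, sdiv, pd_const_mul c (hs _) hx, Finset.mul_sum]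

theorem congr (hh : IsSphereDiv h) (e : ∀ x : E3, ‖x‖ = 1 → g x = h x) : IsSphereDiv g := by
  obtain ⟨ξ, hs, ht, he⟩ := hh
  exact ⟨ξ, hs, ht, fun x hx => (e x hx).trans (he x hx)⟩

end IsSphereDiv

/-! ### Contractions -/

/-- The Euclidean contraction of one-forms. -/
noncomputable def dot (s t : Fin 3 → ℝ) : ℝ := ∑ a, s a * t a

/-- The Euclidean contraction of covariant two-tensors. -/
noncomputable def ddot (s t : Fin 3 → Fin 3 → ℝ) : ℝ := ∑ a, ∑ b, s a b * t a b

/-- The Cartesian components of the differential of a function on the unit sphere. -/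
noncomputable def pgrad (f : E3 → ℝ) (x : E3) : Fin 3 → ℝ := pd f x

/-- The derivatives `∂_a ξ_b` of the Cartesian components. -/
noncomputable def pjac (ξ : E3 → Fin 3 → ℝ) (x : E3) : Fin 3 → Fin 3 → ℝ :=
  fun a b => pd (fun y => ξ y b) x a

/-- The Cartesian divergence of a two-tensor. -/
noncomputable def pdiv2 (X : E3 → Fin 3 → Fin 3 → ℝ) (x : E3) : Fin 3 → ℝ :=
  fun b => ∑ a, pd (fun y => X y a b) x a

/-- The rotated one-form `ε_{ab} t_b`. -/
noncomputable def rot (x : E3) (t : Fin 3 → ℝ) : Fin 3 → ℝ := fun a => ∑ b, vol x a b * t b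

theorem dot_comm (s t : Fin 3 → ℝ) : dot s t = dot t s := by
  simp [dot, mul_comm]

theorem ddot_comm (s t : Fin 3 → Fin 3 → ℝ) : ddot s t = ddot t s := by
  simp [ddot, mul_comm]

theorem hasDerivAt_dot_self {F : ℝ → Fin 3 → ℝ} {F' : Fin 3 → ℝ} {s : ℝ}
    (h : HasDerivAt F F' s) : HasDerivAt (fun s => dot (F s) (F s)) (2 * dot (F s) F') s := by
  have h1 := hasDerivAt_pi.1 h
  have h2 := HasDerivAt.fun_sum (u := Finset.univ) fun a _ => (h1 a).mul (h1 a)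
  refine h2.congr_deriv ?_
  simp only [dot, Finset.mul_sum]
  exact Finset.sum_congr rfl fun a _ => by ring

theorem hasDerivAt_ddot_self {F : ℝ → Fin 3 → Fin 3 → ℝ} {F' : Fin 3 → Fin 3 → ℝ} {s : ℝ}
    (h : HasDerivAt F F' s) : HasDerivAt (fun s => ddot (F s) (F s)) (2 * ddot (F s) F') s := by
  have h1 := fun a => hasDerivAt_pi.1 (hasDerivAt_pi.1 h a)
  have h2 := HasDerivAt.fun_sum (u := Finset.univ) fun a _ =>
    HasDerivAt.fun_sum (u := Finset.univ) fun b _ => (h1 a b).mul (h1 a b)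
  refine h2.congr_deriv ?_
  simp only [ddot, Finset.mul_sum]
  exact Finset.sum_congr rfl fun a _ => Finset.sum_congr rfl fun b _ => by ring

/-- Three terms, because that is the shape of every tensorial evolution equation used below. -/
theorem dot_lincomb (t s₁ s₂ s₃ : Fin 3 → ℝ) (c₁ c₂ c₃ : ℝ) :
    dot t (fun a => c₁ * s₁ a + c₂ * s₂ a + c₃ * s₃ a)
      = c₁ * dot t s₁ + c₂ * dot t s₂ + c₃ * dot t s₃ := by
  simp only [dot, Finset.mul_sum, ← Finset.sum_add_distrib]
  exact Finset.sum_congr rfl fun a _ => by ring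

theorem ddot_lincomb (t s₁ s₂ s₃ : Fin 3 → Fin 3 → ℝ) (c₁ c₂ c₃ : ℝ) :
    ddot t (fun a b => c₁ * s₁ a b + c₂ * s₂ a b + c₃ * s₃ a b)
      = c₁ * ddot t s₁ + c₂ * ddot t s₂ + c₃ * ddot t s₃ := by
  simp only [ddot, Finset.mul_sum, ← Finset.sum_add_distrib]
  exact Finset.sum_congr rfl fun a _ => Finset.sum_congr rfl fun b _ => by ring

section

variable {x : E3} {ξ ζ θ : E3 → Fin 3 → ℝ} {X : E3 → Fin 3 → Fin 3 → ℝ} {f g : E3 → ℝ}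

theorem sdiv_congr (hx : ‖x‖ = 1) (h : ∀ y : E3, ‖y‖ = 1 → ξ y = ζ y) : sdiv ξ x = sdiv ζ x :=
  Finset.sum_congr rfl fun a _ => pd_congr hx (fun y hy => by rw [h y hy]) a

theorem sdiv_lincomb (hξ : ∀ a, SphereSmooth fun y => ξ y a)
    (hζ : ∀ a, SphereSmooth fun y => ζ y a) (hθ : ∀ a, SphereSmooth fun y => θ y a)
    (c₁ c₂ c₃ : ℝ) (hx : ‖x‖ = 1) :
    sdiv (fun y a => c₁ * ξ y a + c₂ * ζ y a + c₃ * θ y a) x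
      = c₁ * sdiv ξ x + c₂ * sdiv ζ x + c₃ * sdiv θ x := by
  have h : ∀ {η : E3 → Fin 3 → ℝ}, (∀ a, SphereSmooth fun y => η y a) → ∀ (c : ℝ) a,
      SphereSmooth fun y => c * η y a := fun h c a => (SphereSmooth.const c).mul (h a)
  simp only [sdiv, Finset.mul_sum, ← Finset.sum_add_distrib]
  refine Finset.sum_congr rfl fun a _ => ?_
  rw [pd_add ((h hξ c₁ a).add (h hζ c₂ a)) (h hθ c₃ a) hx, pd_add (h hξ c₁ a) (h hζ c₂ a) hx,
    pd_const_mul _ (hξ a) hx, pd_const_mul _ (hζ a) hx, pd_const_mul _ (hθ a) hx]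

/-- The product rule for div(gξ). -/
theorem isSphereDiv_smul (hg : SphereSmooth g) (hξ : ∀ a, SphereSmooth fun y => ξ y a)
    (ht : ∀ x : E3, ‖x‖ = 1 → ∑ a, x a * ξ x a = 0) :
    IsSphereDiv fun x => g x * sdiv ξ x + dot (ξ x) (pgrad g x) := by
  refine ⟨fun y a => g y * ξ y a, fun a => hg.mul (hξ a), fun x hx => ?_, fun x hx => ?_⟩
  · simp only [mul_left_comm _ (g x), ← Finset.mul_sum, ht x hx, mul_zero]
  · rw [sdiv_smul hg hξ hx]
    rfl

/-- The product rule for g times the rotation of ξ. Rotation annihilates the normal direction, so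
the resulting one-form is tangential automatically. -/
theorem isSphereDiv_rotate (hg : SphereSmooth g) (hξ : ∀ a, SphereSmooth fun y => ξ y a) :
    IsSphereDiv fun x => g x * scurl ξ x - dot (ξ x) (rot x (pgrad g x)) := by
  refine ⟨fun y b => g y * ∑ a, vol y b a * ξ y a,
    fun b => hg.mul (SphereSmooth.sum _ fun a _ => (sphereSmooth_vol b a).mul (hξ a)),
    fun x hx => ?_, fun x hx => ?_⟩
  · simp only [mul_left_comm _ (g x), ← Finset.mul_sum]
    simp only [Finset.mul_sum]
    rw [Finset.sum_comm]
    refine Finset.sum_eq_zero fun a _ => ?_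
    have := sum_mul_vol x a
    calc ∑ b, g x * (x b * (vol x b a * ξ x a))
        = -(g x * ξ x a) * ∑ b, x b * vol x a b := by
          rw [Finset.mul_sum]
          exact Finset.sum_congr rfl fun b _ => by rw [vol_antisymm x b a]; ring
      _ = 0 := by rw [this, mul_zero]
  · rw [sdiv_rotate hg hξ hx]
    simp only [dot, rot, pgrad, Finset.mul_sum, mul_assoc]

/-- The product rule for the contraction of X with ξ in the second slot; tangentiality comes from
the first slot of X. -/
theorem isSphereDiv_contract (hX : ∀ a b, SphereSmooth fun y => X y a b)
    (hT : ∀ x : E3, ‖x‖ = 1 → ∀ b, ∑ a, x a * X x a b = 0)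
    (hξ : ∀ a, SphereSmooth fun y => ξ y a) :
    IsSphereDiv fun x => dot (ξ x) (pdiv2 X x) + ddot (X x) (pjac ξ x) := by
  refine ⟨fun y a => ∑ b, X y a b * ξ y b,
    fun a => SphereSmooth.sum _ fun b _ => (hX a b).mul (hξ b), fun x hx => ?_, fun x hx => ?_⟩
  · simp only [Finset.mul_sum]
    rw [Finset.sum_comm]
    refine Finset.sum_eq_zero fun b _ => ?_
    simp only [← mul_assoc, ← Finset.sum_mul, hT x hx b, zero_mul]
  · rw [sdiv_contract hX hξ hx]
    rfl

theorem dot_D1star {r : ℝ} (hr : r ≠ 0) (hf : SphereSmooth f) (hg : SphereSmooth g)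
    (hx : ‖x‖ = 1) (t : Fin 3 → ℝ) :
    dot t (D1star r f g x) = -dot t (pgrad f x) + dot t (rot x (pgrad g x)) := by
  rw [dot, sum_mul_D1star hr hf hg hx]
  simp only [dot, rot, pgrad, Finset.mul_sum, mul_assoc]

theorem dot_div2 (r : ℝ) (hX : ∀ a b, SphereSmooth fun y => X y a b) (hx : ‖x‖ = 1)
    {t : Fin 3 → ℝ} (ht : ∑ a, x a * t a = 0) :
    dot t (div2 r X x) = (r ^ 2)⁻¹ * dot t (pdiv2 X x) := sum_mul_div2 r hX hx ht

theorem ddot_D2star (r : ℝ) (hξ : ∀ a, SphereSmooth fun y => ξ y a)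
    (hx : ‖x‖ = 1) {T : Fin 3 → Fin 3 → ℝ} (hT : ∀ b, ∑ a, x a * T a b = 0)
    (hs : ∀ a b, T a b = T b a) (htr : ∑ a, T a a = 0) :
    ddot T (D2star r ξ x) = -ddot T (pjac ξ x) := sum_mul_D2star r hξ hx hT hs htr

end

/-! ### Time derivatives of divergences -/

theorem sdiv_hasDerivAt_u {F : OneForm} (hF : SmoothField F) (u v : ℝ) {x : E3} (hx : ‖x‖ = 1) :
    HasDerivAt (fun s => sdiv (F s v) x) (sdiv (dU F u v) x) u := by
  have h := HasDerivAt.fun_sum (u := Finset.univ)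
    fun a (_ : a ∈ Finset.univ) => (hF.comp1 a).pd_hasDerivAt_u u v hx a
  refine h.congr_deriv (Finset.sum_congr rfl fun a _ => pd_congr hx (fun y hy => ?_) a)
  exact ((hF.comp1 a).hasDerivAt_u u v hy).unique (hasDerivAt_pi.1 (hF.hasDerivAt_u u v hy) a)

theorem sdiv_hasDerivAt_v {F : OneForm} (hF : SmoothField F) (u v : ℝ) {x : E3} (hx : ‖x‖ = 1) :
    HasDerivAt (fun s => sdiv (F u s) x) (sdiv (dV F u v) x) v := by
  have h := HasDerivAt.fun_sum (u := Finset.univ)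
    fun a (_ : a ∈ Finset.univ) => (hF.comp1 a).pd_hasDerivAt_v u v hx a
  refine h.congr_deriv (Finset.sum_congr rfl fun a _ => pd_congr hx (fun y hy => ?_) a)
  exact ((hF.comp1 a).hasDerivAt_v u v hy).unique (hasDerivAt_pi.1 (hF.hasDerivAt_v u v hy) a)

theorem SmoothField.smul {V : Type} [NormedAddCommGroup V] [NormedSpace ℝ V] {a : ℝ → ℝ → ℝ}
    {F : Field V} (ha : ContDiff ℝ ∞ fun p : ℝ × ℝ => a p.1 p.2) (hF : SmoothField F) :
    SmoothField fun u v x => a u v • F u v x :=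
  ContDiffOn.smul (SmoothField.of_contDiff ha) hF

/-! ### Evolution of the quantities in the flux densities -/

namespace Pert

section evolution

variable {bg : RN} {S : Pert} {u v : ℝ} {y : E3}

theorem dU_chih (h : NullStructureAt bg S u v y) :
    dU (fun u v x => bg.Om u v • S.chih u v x) u v y = fun a b =>
      -(bg.Om u v ^ 2 / bg.rad u v) * (bg.Om u v • S.chih u v y) a b
      + -(bg.Om u v ^ 2 / bg.rad u v) * (bg.Om u v • S.chihb u v y) a b
      + -(2 * bg.Om u v ^ 2) * D2star (bg.rad u v) (S.eta u v) y a b := by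
  ext a b
  have h1 := congrFun (congrFun h.chih_3 a) b
  have hO := (bg.Om_pos u v).ne'
  simp only [nab3, RN.trchi, RN.trchib, Pi.add_apply, Pi.sub_apply, Pi.smul_apply, smul_eq_mul,
    Nat.cast_ofNat] at h1 ⊢
  -- Writing the derivative as Ω(Ω⁻¹ ∂_u ·) exposes the combination that occurs in `nab3`, so that Ω
  -- times the equation closes the goal.
  rw [← mul_inv_cancel_left₀ hO (dU (V := Fin 3 → Fin 3 → ℝ) _ u v y a b)]
  linear_combination bg.Om u v * h1

theorem dV_chihb (h : NullStructureAt bg S u v y) :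
    dV (fun u v x => bg.Om u v • S.chihb u v x) u v y = fun a b =>
      (bg.Om u v ^ 2 / bg.rad u v) * (bg.Om u v • S.chihb u v y) a b
      + (bg.Om u v ^ 2 / bg.rad u v) * (bg.Om u v • S.chih u v y) a b
      + -(2 * bg.Om u v ^ 2) * D2star (bg.rad u v) (S.etab u v) y a b := by
  ext a b
  have h1 := congrFun (congrFun h.chihb_4 a) b
  have hO := (bg.Om_pos u v).ne'
  simp only [nab4, RN.trchi, RN.trchib, Pi.add_apply, Pi.sub_apply, Pi.smul_apply, smul_eq_mul,
    Nat.cast_ofNat] at h1 ⊢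
  rw [← mul_inv_cancel_left₀ hO (dV (V := Fin 3 → Fin 3 → ℝ) _ u v y a b)]
  linear_combination bg.Om u v * h1

theorem dU_etab (h : NullStructureAt bg S u v y) :
    dU S.etab u v y = fun a => -(bg.Om u v ^ 2 / bg.rad u v) * S.eta u v y a
      + bg.Om u v * S.betab u v y a + (bg.Om u v * bg.rhoF u v) * S.betabF u v y a := by
  ext a
  have h1 := congrFun h.etab_3 a
  have hO := (bg.Om_pos u v).ne'
  simp only [nab3, RN.trchib, Pi.add_apply, Pi.sub_apply, Pi.smul_apply, smul_eq_mul,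
    Nat.cast_one] at h1 ⊢
  rw [← mul_inv_cancel_left₀ hO (dU (V := Fin 3 → ℝ) _ u v y a)]
  linear_combination bg.Om u v * h1

theorem dV_eta (h : NullStructureAt bg S u v y) :
    dV S.eta u v y = fun a => (bg.Om u v ^ 2 / bg.rad u v) * S.etab u v y a
      + -bg.Om u v * S.beta u v y a + -(bg.Om u v * bg.rhoF u v) * S.betaF u v y a := by
  ext a
  have h1 := congrFun h.eta_4 a
  have hO := (bg.Om_pos u v).ne'
  simp only [nab4, RN.trchi, Pi.sub_apply, Pi.smul_apply, smul_eq_mul,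
    Nat.cast_one] at h1 ⊢
  rw [← mul_inv_cancel_left₀ hO (dV (V := Fin 3 → ℝ) _ u v y a)]
  linear_combination bg.Om u v * h1

theorem dU_betaF (h : MaxwellAt bg S u v y) :
    dU S.betaF u v y = fun a => bg.om u v * S.betaF u v y a
      + -bg.Om u v * D1star (bg.rad u v) (S.rho1F u v) (S.sigma1F u v) y a
      + (2 * bg.Om u v * bg.rhoF u v) * S.eta u v y a := by
  ext a
  have h1 := congrFun h.betaF_3 a
  have hO := (bg.Om_pos u v).ne'
  have h2 : bg.ombh u v = -((bg.Om u v)⁻¹ * bg.om u v) := by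
    simp only [RN.ombh, RN.omb, RN.om]; ring
  simp only [nab3, RN.trchib, h2, Pi.add_apply, Pi.sub_apply, Pi.neg_apply, Pi.smul_apply,
    smul_eq_mul, Nat.cast_one] at h1 ⊢
  rw [← mul_inv_cancel_left₀ hO (dU (V := Fin 3 → ℝ) _ u v y a), ← mul_inv_cancel_left₀ hO (bg.om u v)]
  linear_combination bg.Om u v * h1

theorem dV_betabF (h : MaxwellAt bg S u v y) :
    dV S.betabF u v y = fun a => -bg.om u v * S.betabF u v y a
      + bg.Om u v * D1star (bg.rad u v) (S.rho1F u v) (fun z => -S.sigma1F u v z) y a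
      + -(2 * bg.Om u v * bg.rhoF u v) * S.etab u v y a := by
  ext a
  have h1 := congrFun h.betabF_4 a
  have hO := (bg.Om_pos u v).ne'
  simp only [nab4, RN.trchi, RN.omh, Pi.add_apply, Pi.sub_apply, Pi.smul_apply,
    smul_eq_mul, Nat.cast_one] at h1 ⊢
  rw [← mul_inv_cancel_left₀ hO (dV (V := Fin 3 → ℝ) _ u v y a), ← mul_inv_cancel_left₀ hO (bg.om u v)]
  linear_combination bg.Om u v * h1

theorem dU_rho1F (h : MaxwellAt bg S u v y) :
    dU S.rho1F u v y = 2 * bg.Om u v ^ 2 / bg.rad u v * S.rho1F u v y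
      - bg.Om u v * div1 (bg.rad u v) (S.betabF u v) y - bg.rhoF u v * S.Otrchib u v y := by
  have h1 := h.rho1F_3
  have hO := (bg.Om_pos u v).ne'
  simp only [nab3, RN.trchib, smul_eq_mul, Nat.cast_zero] at h1
  rw [← mul_inv_cancel_left₀ hO (dU _ u v y), ← mul_inv_cancel_left₀ hO (bg.rhoF u v)]
  linear_combination bg.Om u v * h1

theorem dV_rho1F (h : MaxwellAt bg S u v y) :
    dV S.rho1F u v y = -(2 * bg.Om u v ^ 2 / bg.rad u v * S.rho1F u v y)
      + bg.Om u v * div1 (bg.rad u v) (S.betaF u v) y - bg.rhoF u v * S.Otrchi u v y := by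
  have h1 := h.rho1F_4
  have hO := (bg.Om_pos u v).ne'
  simp only [nab4, RN.trchi, smul_eq_mul, Nat.cast_zero] at h1
  rw [← mul_inv_cancel_left₀ hO (dV _ u v y), ← mul_inv_cancel_left₀ hO (bg.rhoF u v)]
  linear_combination bg.Om u v * h1

theorem dU_sigma1F (h : MaxwellAt bg S u v y) :
    dU S.sigma1F u v y = 2 * bg.Om u v ^ 2 / bg.rad u v * S.sigma1F u v y
      + bg.Om u v * curl (bg.rad u v) (S.betabF u v) y := by
  have h1 := h.sigma1F_3
  have hO := (bg.Om_pos u v).ne'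
  simp only [nab3, RN.trchib, smul_eq_mul, Nat.cast_zero] at h1
  rw [← mul_inv_cancel_left₀ hO (dU _ u v y)]
  linear_combination bg.Om u v * h1

theorem dV_sigma1F (h : MaxwellAt bg S u v y) :
    dV S.sigma1F u v y = -(2 * bg.Om u v ^ 2 / bg.rad u v * S.sigma1F u v y)
      + bg.Om u v * curl (bg.rad u v) (S.betaF u v) y := by
  have h1 := h.sigma1F_4
  have hO := (bg.Om_pos u v).ne'
  simp only [nab4, RN.trchi, smul_eq_mul, Nat.cast_zero] at h1
  rw [← mul_inv_cancel_left₀ hO (dV _ u v y)]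
  linear_combination bg.Om u v * h1

theorem dU_rho1 (h : BianchiAt bg S u v y) :
    dU S.rho1 u v y = 3 * bg.Om u v ^ 2 / bg.rad u v * S.rho1 u v y
      - bg.Om u v * div1 (bg.rad u v) (S.betab u v) y
      - bg.Om u v * bg.rhoF u v * div1 (bg.rad u v) (S.betabF u v) y
      - (3 / 2 * bg.rho u v + bg.rhoF u v ^ 2) * S.Otrchib u v y
      + 4 * bg.Om u v ^ 2 / bg.rad u v * bg.rhoF u v * S.rho1F u v y := by
  have h1 := h.rho1_3
  have hO := (bg.Om_pos u v).ne'
  simp only [nab3, RN.trchib, smul_eq_mul, Nat.cast_zero] at h1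
  rw [← mul_inv_cancel_left₀ hO (dU _ u v y), ← mul_inv_cancel_left₀ hO (S.Otrchib u v y)]
  linear_combination bg.Om u v * h1

theorem dV_rho1 (h : BianchiAt bg S u v y) :
    dV S.rho1 u v y = -(3 * bg.Om u v ^ 2 / bg.rad u v * S.rho1 u v y)
      + bg.Om u v * div1 (bg.rad u v) (S.beta u v) y
      + bg.Om u v * bg.rhoF u v * div1 (bg.rad u v) (S.betaF u v) y
      - (3 / 2 * bg.rho u v + bg.rhoF u v ^ 2) * S.Otrchi u v y
      - 4 * bg.Om u v ^ 2 / bg.rad u v * bg.rhoF u v * S.rho1F u v y := by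
  have h1 := h.rho1_4
  have hO := (bg.Om_pos u v).ne'
  simp only [nab4, RN.trchi, smul_eq_mul, Nat.cast_zero] at h1
  rw [← mul_inv_cancel_left₀ hO (dV _ u v y), ← mul_inv_cancel_left₀ hO (S.Otrchi u v y)]
  linear_combination bg.Om u v * h1

end evolution

end Pert

/-! ### The flux densities and their divergence identity -/

/-- Both densities have this form along a null line, with e = 1 for the outgoing and e = −1 for the
ingoing one. `X`, `n`, `m` stand for squared Euclidean norms and `d` for the unit-sphere divergence
of η̲ or η. -/
theorem hasDerivAt_fluxDensity {r O X n m σ p A ρ d : ℝ → ℝ}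
    {r' O' X' n' m' σ' p' A' ρ' d' t : ℝ} (e : ℝ) (h0 : r t ≠ 0)
    (hr : HasDerivAt r r' t) (hO : HasDerivAt O O' t) (hX : HasDerivAt X X' t)
    (hn : HasDerivAt n n' t) (hm : HasDerivAt m m' t) (hσ : HasDerivAt σ σ' t)
    (hp : HasDerivAt p p' t) (hA : HasDerivAt A A' t) (hρ : HasDerivAt ρ ρ' t)
    (hd : HasDerivAt d d' t) :
    HasDerivAt (fun t => (r t ^ 2)⁻¹ * X t + 2 * O t ^ 2 * (n t + m t)
        + 2 * (O t ^ 2 * r t ^ 2) * (σ t ^ 2 + p t ^ 2)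
        + e * (r t ^ 3 * A t) * (ρ t + (r t ^ 2)⁻¹ * d t))
      ((r t ^ 2)⁻¹ * X' - 2 * r' / r t ^ 3 * X t + 4 * O t * O' * (n t + m t)
        + 2 * O t ^ 2 * (n' + m')
        + 4 * (O t * O' * r t ^ 2 + O t ^ 2 * r t * r') * (σ t ^ 2 + p t ^ 2)
        + 4 * (O t ^ 2 * r t ^ 2) * (σ t * σ' + p t * p')
        + e * (3 * r t ^ 2 * r' * A t + r t ^ 3 * A') * (ρ t + (r t ^ 2)⁻¹ * d t)
        + e * (r t ^ 3 * A t) * (ρ' + (r t ^ 2)⁻¹ * d' - 2 * r' / r t ^ 3 * d t)) t := by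
  have hi : HasDerivAt (fun t => (r t ^ 2)⁻¹) (-(2 * r' / r t ^ 3)) t := by
    refine ((hr.pow 2).inv (pow_ne_zero 2 h0)).congr_deriv ?_
    simp only [Pi.pow_apply]
    field_simp
    ring
  have hO2 := hO.pow 2
  have hr2 := hr.pow 2
  have h := (((hi.mul hX).add ((hO2.const_mul 2).mul (hn.add hm))).add
    (((hO2.mul hr2).const_mul 2).mul ((hσ.pow 2).add (hp.pow 2)))).add
    ((((hr.pow 3).mul hA).const_mul e).mul (hρ.add (hi.mul hd)))
  refine h.congr_deriv ?_
  simp only [Pi.pow_apply, Pi.mul_apply, Pi.add_apply]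
  norm_num
  ring

theorem dot_add (t s₁ s₂ : Fin 3 → ℝ) : dot t (s₁ + s₂) = dot t s₁ + dot t s₂ := by
  simp [dot, mul_add, Finset.sum_add_distrib]

theorem dot_sub (t s₁ s₂ : Fin 3 → ℝ) : dot t (s₁ - s₂) = dot t s₁ - dot t s₂ := by
  simp [dot, mul_sub, Finset.sum_sub_distrib]

theorem dot_smul (t s : Fin 3 → ℝ) (c : ℝ) : dot t (c • s) = c * dot t s := by
  simp [dot, Finset.mul_sum, mul_left_comm]

namespace Pert

section density

variable {bg : RN} {S : Pert}

/-- Normal form with the powers of r from the metric contractions combined with the weight r². The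
factor 1 is the sign `e` of `hasDerivAt_fluxDensity`. -/
theorem densityU_eq (hS : S.IsSmooth) (u v : ℝ) {x : E3} (hx : ‖x‖ = 1) :
    S.densityU bg u v x
      = (bg.rad u v ^ 2)⁻¹ * ddot (bg.Om u v • S.chih u v x) (bg.Om u v • S.chih u v x)
        + 2 * bg.Om u v ^ 2 * (dot (S.etab u v x) (S.etab u v x)
          + dot (S.betaF u v x) (S.betaF u v x))
        + 2 * (bg.Om u v ^ 2 * bg.rad u v ^ 2) * (S.sigma1F u v x ^ 2 + S.rho1F u v x ^ 2)
        + 1 * (bg.rad u v ^ 3 * S.Otrchi u v x)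
          * (S.rho1 u v x + (bg.rad u v ^ 2)⁻¹ * sdiv (S.etab u v) x) := by
  have hr := (bg.rad_pos u v).ne'
  have h1 : ∀ t : Fin 3 → ℝ, inner1 (bg.rad u v) (bg.Om u v • t) (bg.Om u v • t)
      = (bg.rad u v ^ 2)⁻¹ * bg.Om u v ^ 2 * dot t t := fun t => by
    simp only [inner1, dot, Pi.smul_apply, smul_eq_mul, Finset.mul_sum]
    exact Finset.sum_congr rfl fun a _ => by ring
  rw [densityU, h1, h1, div1_eq _ (fun a => (hS.etab.1.comp1 a).sphereSmooth u v) hx, inner2]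
  unfold ddot
  field_simp
  ring

theorem densityV_eq (hS : S.IsSmooth) (u v : ℝ) {x : E3} (hx : ‖x‖ = 1) :
    S.densityV bg u v x
      = (bg.rad u v ^ 2)⁻¹ * ddot (bg.Om u v • S.chihb u v x) (bg.Om u v • S.chihb u v x)
        + 2 * bg.Om u v ^ 2 * (dot (S.eta u v x) (S.eta u v x)
          + dot (S.betabF u v x) (S.betabF u v x))
        + 2 * (bg.Om u v ^ 2 * bg.rad u v ^ 2) * (S.sigma1F u v x ^ 2 + S.rho1F u v x ^ 2)
        + (-1) * (bg.rad u v ^ 3 * S.Otrchib u v x)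
          * (S.rho1 u v x + (bg.rad u v ^ 2)⁻¹ * sdiv (S.eta u v) x) := by
  have hr := (bg.rad_pos u v).ne'
  have h1 : ∀ t : Fin 3 → ℝ, inner1 (bg.rad u v) (bg.Om u v • t) (bg.Om u v • t)
      = (bg.rad u v ^ 2)⁻¹ * bg.Om u v ^ 2 * dot t t := fun t => by
    simp only [inner1, dot, Pi.smul_apply, smul_eq_mul, Finset.mul_sum]
    exact Finset.sum_congr rfl fun a _ => by ring
  rw [densityV, h1, h1, div1_eq _ (fun a => (hS.eta.1.comp1 a).sphereSmooth u v) hx, inner2]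
  unfold ddot
  field_simp
  ring

theorem lapse_smooth (hS : S.IsSmooth) : SmoothField (S.lapse bg) :=
  (SmoothField.of_contDiff (bg.Om_contDiff.inv fun _ => (bg.Om_pos _ _).ne')).mul hS.Om1

variable {u v : ℝ} {x : E3}

theorem smul_symTraceless (c : ℝ) {T : Fin 3 → Fin 3 → ℝ} {x : E3}
    (hT : (∀ b, ∑ a, x a * T a b = 0) ∧ (∀ a b, T a b = T b a) ∧ ∑ a, T a a = 0) :
    (∀ b, ∑ a, x a * (c • T) a b = 0) ∧ (∀ a b, (c • T) a b = (c • T) b a)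
      ∧ ∑ a, (c • T) a a = 0 := by
  refine ⟨fun b => ?_, fun a b => ?_, ?_⟩
  · simp only [Pi.smul_apply, smul_eq_mul, mul_left_comm _ c, ← Finset.mul_sum, hT.1 b, mul_zero]
  · simp only [Pi.smul_apply, hT.2.1 a b]
  · simp only [Pi.smul_apply, smul_eq_mul, ← Finset.mul_sum, hT.2.2, mul_zero]

/-- The weights are tuned so that |χ̂|² and |f|² leave no term of their own, and div β̲, q div f̲
cancel inside the derivative of ρ + div η̲. What survives is arranged for matching with
`dV_densityV`. -/
theorem dU_densityU (hS : S.IsSmooth) (hN : ∀ x : E3, ‖x‖ = 1 → NullStructureAt bg S u v x)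
    (hM : ∀ x : E3, ‖x‖ = 1 → MaxwellAt bg S u v x)
    (hB : ∀ x : E3, ‖x‖ = 1 → BianchiAt bg S u v x) (hx : ‖x‖ = 1) :
    dU (S.densityU bg) u v x
      = -2 * bg.Om u v ^ 2 / bg.rad u v ^ 3
          * ddot (bg.Om u v • S.chih u v x) (bg.Om u v • S.chihb u v x)
        + 4 * bg.Om u v ^ 2 / bg.rad u v ^ 2
          * ddot (bg.Om u v • S.chih u v x) (pjac (S.eta u v) x)
        - 4 * bg.om u v * bg.Om u v ^ 2 * dot (S.etab u v x) (S.etab u v x)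
        + 4 * bg.Om u v ^ 2 * (-(bg.Om u v ^ 2 / bg.rad u v) * dot (S.etab u v x) (S.eta u v x)
          + bg.Om u v * dot (S.etab u v x) (S.betab u v x)
          + bg.Om u v * bg.rhoF u v * dot (S.etab u v x) (S.betabF u v x))
        + 4 * bg.Om u v ^ 3 * (dot (S.betaF u v x) (pgrad (S.rho1F u v) x)
          - dot (S.betaF u v x) (rot x (pgrad (S.sigma1F u v) x)))
        + 8 * bg.Om u v ^ 3 * bg.rhoF u v * dot (S.betaF u v x) (S.eta u v x)
        + 4 * (bg.Om u v ^ 4 * bg.rad u v - bg.om u v * bg.Om u v ^ 2 * bg.rad u v ^ 2)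
          * (S.sigma1F u v x ^ 2 + S.rho1F u v x ^ 2)
        + 4 * bg.Om u v ^ 3 * (S.sigma1F u v x * scurl (S.betabF u v) x
          - S.rho1F u v x * sdiv (S.betabF u v) x)
        - 4 * bg.Om u v ^ 2 * bg.rad u v ^ 2 * bg.rhoF u v * S.rho1F u v x * S.Otrchib u v x
        + bg.Om u v ^ 2 * bg.rad u v ^ 2 * (S.Otrchi u v x
            * (S.rho1 u v x - (bg.rad u v ^ 2)⁻¹ * sdiv (S.eta u v) x
              + 4 * bg.rhoF u v * S.rho1F u v x)
          - S.Otrchib u v x * (S.rho1 u v x + (bg.rad u v ^ 2)⁻¹ * sdiv (S.etab u v) x))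
        + 2 * bg.Om u v ^ 2 * bg.rad u v ^ 3
          * (S.rho1 u v x + (bg.rad u v ^ 2)⁻¹ * sdiv (S.etab u v) x)
          * (S.rho1 u v x + (bg.rad u v ^ 2)⁻¹ * sdiv (S.eta u v) x
            + 2 * bg.rho u v * S.lapse bg u v x)
        - bg.rad u v ^ 3 * (3 / 2 * bg.rho u v + bg.rhoF u v ^ 2)
          * (S.Otrchi u v x * S.Otrchib u v x) := by
  have hr := (bg.rad_pos u v).ne'
  have hX := hasDerivAt_ddot_self ((SmoothField.smul bg.Om_contDiff hS.chih.1).hasDerivAt_u u v hx)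
  have hn := hasDerivAt_dot_self (hS.etab.1.hasDerivAt_u u v hx)
  have hm := hasDerivAt_dot_self (hS.betaF.1.hasDerivAt_u u v hx)
  have h := hasDerivAt_fluxDensity (r := fun s => bg.rad s v) (t := u) 1 hr
    (bg.rad_hasDerivAt_u u v) (bg.Om_hasDerivAt_u u v)
    hX hn hm (SmoothField.hasDerivAt_u hS.sigma1F u v hx)
    (SmoothField.hasDerivAt_u hS.rho1F u v hx) (SmoothField.hasDerivAt_u hS.Otrchi u v hx)
    (SmoothField.hasDerivAt_u hS.rho1 u v hx) (sdiv_hasDerivAt_u hS.etab.1 u v hx)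
  have hfun : (fun s => S.densityU bg s v x) = _ := funext fun s => densityU_eq hS s v hx
  rw [← hfun] at h
  rw [dU, h.deriv]
  have sm : ∀ {F : OneForm}, IsOneForm F → ∀ a, SphereSmooth fun y => F u v y a :=
    fun hF a => (hF.1.comp1 a).sphereSmooth u v
  -- The evolution equation of η̲ is differentiated along the sphere, so it is needed on the whole
  -- sphere and not only at `x`.
  have hd : sdiv (dU S.etab u v) x = -(bg.Om u v ^ 2 / bg.rad u v) * sdiv (S.eta u v) x
      + bg.Om u v * sdiv (S.betab u v) x + bg.Om u v * bg.rhoF u v * sdiv (S.betabF u v) x := by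
    rw [sdiv_congr hx fun y hy => dU_etab (hN y hy),
      sdiv_lincomb (sm hS.eta) (sm hS.betab) (sm hS.betabF) _ _ _ hx]
  obtain ⟨ht, hT, htr⟩ := smul_symTraceless (bg.Om u v) (hS.chih.2 u v x hx)
  rw [dU_chih (hN x hx), ddot_lincomb, ddot_D2star _ (sm hS.eta) hx ht hT htr,
    dU_etab (hN x hx), dot_lincomb, dU_betaF (hM x hx), dot_lincomb,
    dot_D1star hr (SmoothField.sphereSmooth hS.rho1F u v)
      (SmoothField.sphereSmooth hS.sigma1F u v) hx,
    dU_sigma1F (hM x hx), dU_rho1F (hM x hx), (hN x hx).Otrchi_u, dU_rho1 (hB x hx), hd,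
    curl_eq hr (sm hS.betabF) hx, div1_eq _ (sm hS.betabF) hx, div1_eq _ (sm hS.betab) hx,
    div1_eq _ (sm hS.eta) hx, RN.trchi]
  field_simp
  ring

theorem dV_densityV (hS : S.IsSmooth) (hN : ∀ x : E3, ‖x‖ = 1 → NullStructureAt bg S u v x)
    (hM : ∀ x : E3, ‖x‖ = 1 → MaxwellAt bg S u v x)
    (hB : ∀ x : E3, ‖x‖ = 1 → BianchiAt bg S u v x) (hx : ‖x‖ = 1) :
    dV (S.densityV bg) u v x
      = 2 * bg.Om u v ^ 2 / bg.rad u v ^ 3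
          * ddot (bg.Om u v • S.chihb u v x) (bg.Om u v • S.chih u v x)
        + 4 * bg.Om u v ^ 2 / bg.rad u v ^ 2
          * ddot (bg.Om u v • S.chihb u v x) (pjac (S.etab u v) x)
        + 4 * bg.om u v * bg.Om u v ^ 2 * dot (S.eta u v x) (S.eta u v x)
        + 4 * bg.Om u v ^ 2 * ((bg.Om u v ^ 2 / bg.rad u v) * dot (S.eta u v x) (S.etab u v x)
          - bg.Om u v * dot (S.eta u v x) (S.beta u v x)
          - bg.Om u v * bg.rhoF u v * dot (S.eta u v x) (S.betaF u v x))
        - 4 * bg.Om u v ^ 3 * (dot (S.betabF u v x) (pgrad (S.rho1F u v) x)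
          + dot (S.betabF u v x) (rot x (pgrad (S.sigma1F u v) x)))
        - 8 * bg.Om u v ^ 3 * bg.rhoF u v * dot (S.betabF u v x) (S.etab u v x)
        - 4 * (bg.Om u v ^ 4 * bg.rad u v - bg.om u v * bg.Om u v ^ 2 * bg.rad u v ^ 2)
          * (S.sigma1F u v x ^ 2 + S.rho1F u v x ^ 2)
        + 4 * bg.Om u v ^ 3 * (S.sigma1F u v x * scurl (S.betaF u v) x
          + S.rho1F u v x * sdiv (S.betaF u v) x)
        - 4 * bg.Om u v ^ 2 * bg.rad u v ^ 2 * bg.rhoF u v * S.rho1F u v x * S.Otrchi u v x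
        - bg.Om u v ^ 2 * bg.rad u v ^ 2 * (S.Otrchib u v x
            * (-S.rho1 u v x + (bg.rad u v ^ 2)⁻¹ * sdiv (S.etab u v) x
              - 4 * bg.rhoF u v * S.rho1F u v x)
          + S.Otrchi u v x * (S.rho1 u v x + (bg.rad u v ^ 2)⁻¹ * sdiv (S.eta u v) x))
        - 2 * bg.Om u v ^ 2 * bg.rad u v ^ 3
          * (S.rho1 u v x + (bg.rad u v ^ 2)⁻¹ * sdiv (S.eta u v) x)
          * (S.rho1 u v x + (bg.rad u v ^ 2)⁻¹ * sdiv (S.etab u v) x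
            + 2 * bg.rho u v * S.lapse bg u v x)
        + bg.rad u v ^ 3 * (3 / 2 * bg.rho u v + bg.rhoF u v ^ 2)
          * (S.Otrchi u v x * S.Otrchib u v x) := by
  have hr := (bg.rad_pos u v).ne'
  have hX := hasDerivAt_ddot_self
    ((SmoothField.smul bg.Om_contDiff hS.chihb.1).hasDerivAt_v u v hx)
  have hn := hasDerivAt_dot_self (hS.eta.1.hasDerivAt_v u v hx)
  have hm := hasDerivAt_dot_self (hS.betabF.1.hasDerivAt_v u v hx)
  have h := hasDerivAt_fluxDensity (r := fun s => bg.rad u s) (t := v) (-1) hr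
    (bg.rad_hasDerivAt_v u v) (bg.Om_hasDerivAt_v u v)
    hX hn hm (SmoothField.hasDerivAt_v hS.sigma1F u v hx)
    (SmoothField.hasDerivAt_v hS.rho1F u v hx) (SmoothField.hasDerivAt_v hS.Otrchib u v hx)
    (SmoothField.hasDerivAt_v hS.rho1 u v hx) (sdiv_hasDerivAt_v hS.eta.1 u v hx)
  have hfun : (fun s => S.densityV bg u s x) = _ := funext fun s => densityV_eq hS u s hx
  rw [← hfun] at h
  rw [dV, h.deriv]
  have sm : ∀ {F : OneForm}, IsOneForm F → ∀ a, SphereSmooth fun y => F u v y a :=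
    fun hF a => (hF.1.comp1 a).sphereSmooth u v
  have hd : sdiv (dV S.eta u v) x = (bg.Om u v ^ 2 / bg.rad u v) * sdiv (S.etab u v) x
      + -bg.Om u v * sdiv (S.beta u v) x + -(bg.Om u v * bg.rhoF u v) * sdiv (S.betaF u v) x := by
    rw [sdiv_congr hx fun y hy => dV_eta (hN y hy),
      sdiv_lincomb (sm hS.etab) (sm hS.beta) (sm hS.betaF) _ _ _ hx]
  have hs := SmoothField.sphereSmooth hS.sigma1F u v
  have hs' : SphereSmooth fun z => -S.sigma1F u v z := ContDiffOn.neg hs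
  have hneg : ∀ t : Fin 3 → ℝ, dot t (rot x (pgrad (fun z => -S.sigma1F u v z) x))
      = -dot t (rot x (pgrad (S.sigma1F u v) x)) := fun t => by
    have := fun k => pd_const_mul (-1) hs hx k
    simp only [neg_one_mul] at this
    simp only [dot, rot, pgrad, this, mul_neg, Finset.sum_neg_distrib]
  obtain ⟨ht, hT, htr⟩ := smul_symTraceless (bg.Om u v) (hS.chihb.2 u v x hx)
  rw [dV_chihb (hN x hx), ddot_lincomb, ddot_D2star _ (sm hS.etab) hx ht hT htr,
    dV_eta (hN x hx), dot_lincomb, dV_betabF (hM x hx), dot_lincomb,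
    dot_D1star hr (SmoothField.sphereSmooth hS.rho1F u v) hs' hx, hneg,
    dV_sigma1F (hM x hx), dV_rho1F (hM x hx), (hN x hx).Otrchib_v, dV_rho1 (hB x hx), hd,
    curl_eq hr (sm hS.betaF) hx, div1_eq _ (sm hS.betaF) hx, div1_eq _ (sm hS.beta) hx,
    div1_eq _ (sm hS.etab) hx, RN.trchi]
  field_simp
  ring

/-- In the sum, the terms χ̂ · χ̲̂, s² + p², A A̲, and the products of A, A̲ with ρ and with p
cancel outright. The rest is an explicit combination of product-rule divergences, modulo the Codazzi
equations and 2∇w = η + η̲. -/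
theorem isSphereDiv_fluxDensity (hS : S.IsSmooth)
    (hN : ∀ x : E3, ‖x‖ = 1 → NullStructureAt bg S u v x)
    (hM : ∀ x : E3, ‖x‖ = 1 → MaxwellAt bg S u v x)
    (hB : ∀ x : E3, ‖x‖ = 1 → BianchiAt bg S u v x) :
    IsSphereDiv fun x => dU (S.densityU bg) u v x + dV (S.densityV bg) u v x := by
  have hr := (bg.rad_pos u v).ne'
  have hO := (bg.Om_pos u v).ne'
  have sm : ∀ {F : OneForm}, IsOneForm F → ∀ a, SphereSmooth fun y => F u v y a :=
    fun hF a => (hF.1.comp1 a).sphereSmooth u v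
  have tan : ∀ {F : OneForm}, IsOneForm F → ∀ x : E3, ‖x‖ = 1 → ∑ a, x a * F u v x a = 0 :=
    fun hF x hx => hF.2 u v x hx
  have sms : ∀ {F : Scal}, IsScal F → SphereSmooth (F u v) :=
    fun hF => SmoothField.sphereSmooth hF u v
  have smt : ∀ {F : Tens2}, IsSymTraceless F → ∀ a b, SphereSmooth fun y => F u v y a b :=
    fun hF a b => (hF.1.comp2 a b).sphereSmooth u v
  have smO : ∀ {F : Tens2}, IsSymTraceless F →
      ∀ a b, SphereSmooth fun y => (bg.Om u v • F u v y) a b :=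
    fun hF a b => (SphereSmooth.const _).mul (smt hF a b)
  have tanO : ∀ {F : Tens2}, IsSymTraceless F →
      ∀ x : E3, ‖x‖ = 1 → ∀ b, ∑ a, x a * (bg.Om u v • F u v x) a b = 0 :=
    fun hF x hx => (smul_symTraceless _ (hF.2 u v x hx)).1
  have pdivO : ∀ {F : Tens2}, IsSymTraceless F → ∀ x : E3, ‖x‖ = 1 →
      pdiv2 (fun y => bg.Om u v • F u v y) x = bg.Om u v • pdiv2 (F u v) x := by
    intro F hF x hx
    ext b
    simp only [pdiv2, Pi.smul_apply, smul_eq_mul, Finset.mul_sum]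
    exact Finset.sum_congr rfl fun a _ => pd_const_mul _ (smt hF a b) hx a
  have hw := SmoothField.sphereSmooth (lapse_smooth (bg := bg) hS) u v
  -- The background relation that balances the |η|² and |η̲|² terms against those produced by the
  -- lapse.
  have hom : bg.om u v = -(bg.rad u v * bg.rho u v) / 2 := by
    simp only [RN.om, RN.rho]
    field_simp
    ring
  -- In order: shears against η and η̲; A and A̲ against the same; p against f and f̲; s against the
  -- rotated f and f̲; lapse against η̲ and η. The coefficients are those of the matching terms in
  -- the two derivatives, and are constant on the sphere.
  refine (((((((((isSphereDiv_contract (smO hS.chih) (tanO hS.chih) (sm hS.eta)).add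
    (isSphereDiv_contract (smO hS.chihb) (tanO hS.chihb) (sm hS.etab))).const_mul
      (4 * bg.Om u v ^ 2 / bg.rad u v ^ 2)).add
    (((isSphereDiv_smul (sms hS.Otrchi) (sm hS.eta) (tan hS.eta)).add
      (isSphereDiv_smul (sms hS.Otrchib) (sm hS.etab) (tan hS.etab))).const_mul
        (-2 * bg.Om u v ^ 2))).add
    ((isSphereDiv_smul (sms hS.rho1F) (sm hS.betaF) (tan hS.betaF)).const_mul
      (4 * bg.Om u v ^ 3))).add
    ((isSphereDiv_smul (sms hS.rho1F) (sm hS.betabF) (tan hS.betabF)).const_mul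
      (-4 * bg.Om u v ^ 3))).add
    (((isSphereDiv_rotate (sms hS.sigma1F) (sm hS.betaF)).add
      (isSphereDiv_rotate (sms hS.sigma1F) (sm hS.betabF))).const_mul (4 * bg.Om u v ^ 3))).add
    ((isSphereDiv_smul hw (sm hS.etab) (tan hS.etab)).const_mul
      (4 * bg.Om u v ^ 2 * bg.rad u v * bg.rho u v))).add
    ((isSphereDiv_smul hw (sm hS.eta) (tan hS.eta)).const_mul
      (-4 * bg.Om u v ^ 2 * bg.rad u v * bg.rho u v))).congr fun x hx => ?_
  have hlap : ∀ t : Fin 3 → ℝ, dot t (pgrad (S.lapse bg u v) x)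
      = 1 / 2 * (dot t (S.eta u v x) + dot t (S.etab u v x)) := fun t => by
    have h := congrArg (dot t) (hN x hx).lapse_grad
    rw [show grad (S.lapse bg u v) x = pgrad (S.lapse bg u v) x from funext (grad_apply hw hx),
      dot_smul, dot_add] at h
    linarith
  -- Integration by parts has moved the derivative from η to χ̂ and from η̲ to χ̲̂, so each Codazzi
  -- equation is paired with that one-form.
  have hc1 := congrArg (dot (S.eta u v x)) (hN x hx).codazzi_chih
  have hc2 := congrArg (dot (S.etab u v x)) (hN x hx).codazzi_chihb
  rw [dot_div2 _ (smt hS.chih) hx (tan hS.eta x hx),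
    show grad (S.Otrchi u v) x = pgrad (S.Otrchi u v) x from funext (grad_apply (sms hS.Otrchi) hx)]
    at hc1
  rw [dot_div2 _ (smt hS.chihb) hx (tan hS.etab x hx),
    show grad (S.Otrchib u v) x = pgrad (S.Otrchib u v) x
      from funext (grad_apply (sms hS.Otrchib) hx)] at hc2
  simp only [dot_add, dot_sub, dot_smul, RN.trchi, RN.trchib] at hc1 hc2
  rw [inv_mul_eq_iff_eq_mul₀ (pow_ne_zero 2 hr)] at hc1 hc2
  rw [dU_densityU hS hN hM hB hx, dV_densityV hS hN hM hB hx, pdivO hS.chih x hx,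
    pdivO hS.chihb x hx, dot_smul, dot_smul, hc1, hc2, hlap, hlap, hom,
    dot_comm (S.etab u v x) (S.eta u v x), dot_comm (S.betaF u v x) (S.eta u v x),
    dot_comm (S.betabF u v x) (S.etab u v x),
    ddot_comm (bg.Om u v • S.chihb u v x) (bg.Om u v • S.chih u v x)]
  field_simp
  ring

end density

end Pert

/-! ### Integration over characteristic rectangles -/

theorem SmoothField.congr_sphere {F G : Scal} (hG : SmoothField G)
    (h : ∀ u v (x : E3), ‖x‖ = 1 → F u v x = G u v x) : SmoothField F :=
  ContDiffOn.congr hG fun _ hp => h _ _ _ (norm_normalize hp)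

theorem continuous_sphereIntegral {F : Scal} (hF : SmoothField F) :
    Continuous fun p : ℝ × ℝ => sphereIntegral (F p.1 p.2) := by
  have h := continuous_parametric_integral_of_continuous
    (f := fun (p : ℝ × ℝ) (x : Metric.sphere (0 : E3) 1) => F p.1 p.2 x)
    (μ := (volume : Measure E3).toSphere) (s := Set.univ)
    (hF.continuous.comp (by fun_prop : Continuous fun q : (ℝ × ℝ) × Metric.sphere (0 : E3) 1 =>
      (q.1.1, q.1.2, q.2))) isCompact_univ
  simp only [Measure.restrict_univ] at h
  exact h

theorem integrable_sphere {f : E3 → ℝ}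
    (hf : Continuous fun x : Metric.sphere (0 : E3) 1 => f x) :
    Integrable (fun x : Metric.sphere (0 : E3) 1 => f x) (volume : Measure E3).toSphere :=
  hf.integrable_of_hasCompactSupport (HasCompactSupport.of_compactSpace _)

theorem sphereIntegral_intervalIntegral_swap {f : ℝ → E3 → ℝ}
    (hf : Continuous fun p : ℝ × Metric.sphere (0 : E3) 1 => f p.1 p.2) (a b : ℝ) :
    ∫ s in a..b, sphereIntegral (f s) = sphereIntegral fun x => ∫ s in a..b, f s x := by
  unfold sphereIntegral
  refine intervalIntegral_integral_swap (f := fun s (x : Metric.sphere (0 : E3) 1) => f s x) ?_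
  have h : IntegrableOn (fun p : ℝ × Metric.sphere (0 : E3) 1 => f p.1 p.2)
      (Set.uIoc a b ×ˢ Set.univ) (volume.prod (volume : Measure E3).toSphere) :=
    (hf.continuousOn.integrableOn_compact ((isCompact_uIcc (a := a) (b := b)).prod
      isCompact_univ)).mono_set (Set.prod_mono Set.uIoc_subset_uIcc subset_rfl)
  rwa [IntegrableOn, ← Measure.prod_restrict, Measure.restrict_univ] at h

/-- The fundamental theorem of calculus at each point of the sphere, followed by Fubini. -/
theorem sphereIntegral_sub_u {F : Scal} (hF : SmoothField F) (a b v : ℝ) :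
    sphereIntegral (F b v) - sphereIntegral (F a v) = ∫ s in a..b, sphereIntegral (dU F s v) := by
  have hc := hF.dU.continuous
  have hF' := hF.continuous
  rw [sphereIntegral_intervalIntegral_swap (f := fun s => dU F s v)
    (hc.comp (by fun_prop : Continuous fun p : ℝ × Metric.sphere (0 : E3) 1 => (p.1, v, p.2)))]
  have hi : ∀ u, Integrable (fun x : Metric.sphere (0 : E3) 1 => F u v x)
      (volume : Measure E3).toSphere := fun u => integrable_sphere
    (hF'.comp (by fun_prop : Continuous fun x : Metric.sphere (0 : E3) 1 => (u, v, x)))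
  unfold sphereIntegral
  rw [← integral_sub (hi b) (hi a)]
  congr 1
  ext x
  refine (intervalIntegral.integral_eq_sub_of_hasDerivAt
    (fun s _ => hF.hasDerivAt_u s v (by simp)) (Continuous.intervalIntegrable ?_ _ _)).symm
  exact hc.comp (by fun_prop : Continuous fun s : ℝ => (s, v, x))

theorem sphereIntegral_sub_v {F : Scal} (hF : SmoothField F) (u a b : ℝ) :
    sphereIntegral (F u b) - sphereIntegral (F u a) = ∫ s in a..b, sphereIntegral (dV F u s) := by
  have hc := hF.dV.continuous
  have hF' := hF.continuous
  rw [sphereIntegral_intervalIntegral_swap (f := fun s => dV F u s)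
    (hc.comp (by fun_prop : Continuous fun p : ℝ × Metric.sphere (0 : E3) 1 => (u, p.1, p.2)))]
  have hi : ∀ v, Integrable (fun x : Metric.sphere (0 : E3) 1 => F u v x)
      (volume : Measure E3).toSphere := fun v => integrable_sphere
    (hF'.comp (by fun_prop : Continuous fun x : Metric.sphere (0 : E3) 1 => (u, v, x)))
  unfold sphereIntegral
  rw [← integral_sub (hi b) (hi a)]
  congr 1
  ext x
  refine (intervalIntegral.integral_eq_sub_of_hasDerivAt
    (fun s _ => hF.hasDerivAt_v u s (by simp)) (Continuous.intervalIntegrable ?_ _ _)).symm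
  exact hc.comp (by fun_prop : Continuous fun s : ℝ => (u, s, x))

/-- Green's theorem on the rectangle for the sphere averages. The differences of opposite fluxes are
double integrals of ∂_u F and ∂_v G, which are opposite after exchanging the order of integration.
-/
theorem flux_balance {F G : Scal} (hF : SmoothField F) (hG : SmoothField G) {u₀ u₁ v₀ v₁ : ℝ}
    (hu : u₀ ≤ u₁) (hv : v₀ ≤ v₁)
    (h : ∀ u ∈ Set.Icc u₀ u₁, ∀ v ∈ Set.Icc v₀ v₁,
      sphereIntegral (fun x => dU F u v x + dV G u v x) = 0) :
    (∫ v in v₀..v₁, sphereIntegral (F u₁ v)) + ∫ u in u₀..u₁, sphereIntegral (G u v₁)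
      = (∫ v in v₀..v₁, sphereIntegral (F u₀ v)) + ∫ u in u₀..u₁, sphereIntegral (G u v₀) := by
  have cF := continuous_sphereIntegral hF
  have cG := continuous_sphereIntegral hG
  have cF' := continuous_sphereIntegral hF.dU
  have cG' := continuous_sphereIntegral hG.dV
  have iF : ∀ u, IntervalIntegrable (fun v => sphereIntegral (F u v)) volume v₀ v₁ := fun u =>
    (cF.comp (by fun_prop : Continuous fun v : ℝ => (u, v))).intervalIntegrable _ _
  have iG : ∀ v, IntervalIntegrable (fun u => sphereIntegral (G u v)) volume u₀ u₁ := fun v =>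
    (cG.comp (by fun_prop : Continuous fun u : ℝ => (u, v))).intervalIntegrable _ _
  have e1 : (∫ v in v₀..v₁, sphereIntegral (F u₁ v)) - (∫ v in v₀..v₁, sphereIntegral (F u₀ v))
      = ∫ v in v₀..v₁, ∫ u in u₀..u₁, sphereIntegral (dU F u v) := by
    rw [← intervalIntegral.integral_sub (iF u₁) (iF u₀)]
    simp only [sphereIntegral_sub_u hF]
  have e2 : (∫ u in u₀..u₁, sphereIntegral (G u v₁)) - (∫ u in u₀..u₁, sphereIntegral (G u v₀))
      = ∫ u in u₀..u₁, ∫ v in v₀..v₁, sphereIntegral (dV G u v) := by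
    rw [← intervalIntegral.integral_sub (iG v₁) (iG v₀)]
    simp only [sphereIntegral_sub_v hG]
  have e3 : ∫ v in v₀..v₁, ∫ u in u₀..u₁, sphereIntegral (dU F u v)
      = ∫ u in u₀..u₁, ∫ v in v₀..v₁, sphereIntegral (dU F u v) := by
    refine intervalIntegral_intervalIntegral_swap
      (F := fun v u => sphereIntegral (dU F u v)) ?_
    refine (ContinuousOn.integrableOn_compact
      ((isCompact_uIcc (a := v₀) (b := v₁)).prod (isCompact_uIcc (a := u₀) (b := u₁)))
      (cF'.comp continuous_swap).continuousOn).mono_set ?_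
    exact Set.prod_mono Set.uIoc_subset_uIcc Set.uIoc_subset_uIcc
  have e4 : ∫ u in u₀..u₁, ∫ v in v₀..v₁, sphereIntegral (dU F u v)
      = -∫ u in u₀..u₁, ∫ v in v₀..v₁, sphereIntegral (dV G u v) := by
    rw [← intervalIntegral.integral_neg]
    refine intervalIntegral.integral_congr fun u hu' => ?_
    rw [← intervalIntegral.integral_neg]
    refine intervalIntegral.integral_congr fun v hv' => ?_
    rw [Set.uIcc_of_le hu] at hu'
    rw [Set.uIcc_of_le hv] at hv'
    have h0 := h u hu' v hv'
    have hsplit : sphereIntegral (fun x => dU F u v x + dV G u v x)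
        = sphereIntegral (dU F u v) + sphereIntegral (dV G u v) :=
      integral_add (integrable_sphere (hF.dU.continuous.comp
        (by fun_prop : Continuous fun x : Metric.sphere (0 : E3) 1 => (u, v, x))))
        (integrable_sphere (hG.dV.continuous.comp
        (by fun_prop : Continuous fun x : Metric.sphere (0 : E3) 1 => (u, v, x))))
    rw [hsplit] at h0
    linarith
  linarith

namespace Pert

variable {bg : RN} {S : Pert}

theorem smooth_sdiv {F : OneForm} (hF : IsOneForm F) :
    SmoothField fun u v x => sdiv (F u v) x :=
  SmoothField.sum _ fun a _ => (hF.1.comp1 a).pd a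

theorem smooth_dot {F : OneForm} (hF : IsOneForm F) :
    SmoothField fun u v x => dot (F u v x) (F u v x) :=
  SmoothField.sum _ fun a _ => (hF.1.comp1 a).mul (hF.1.comp1 a)

theorem smooth_ddot {F : Tens2} (hF : SmoothField F) :
    SmoothField fun u v x => ddot (F u v x) (F u v x) :=
  SmoothField.sum _ fun a _ => SmoothField.sum _ fun b _ => (hF.comp2 a b).mul (hF.comp2 a b)

theorem smooth_fluxDensity {X : Tens2} {ξ ζ θ : OneForm} {s p A r : Scal} (bg : RN) (e : ℝ)
    (hX : SmoothField X) (hξ : IsOneForm ξ) (hζ : IsOneForm ζ) (hθ : IsOneForm θ)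
    (hs : SmoothField s) (hp : SmoothField p) (hA : SmoothField A) (hr : SmoothField r) :
    SmoothField fun u v x => (bg.rad u v ^ 2)⁻¹ * ddot (X u v x) (X u v x)
        + 2 * bg.Om u v ^ 2 * (dot (ξ u v x) (ξ u v x) + dot (ζ u v x) (ζ u v x))
        + 2 * (bg.Om u v ^ 2 * bg.rad u v ^ 2) * (s u v x ^ 2 + p u v x ^ 2)
        + e * (bg.rad u v ^ 3 * A u v x)
          * (r u v x + (bg.rad u v ^ 2)⁻¹ * sdiv (θ u v) x) := by
  have hR := SmoothField.of_contDiff bg.rad_contDiff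
  have hO := SmoothField.of_contDiff bg.Om_contDiff
  have hi : SmoothField fun u v _ => (bg.rad u v ^ 2)⁻¹ :=
    SmoothField.of_contDiff ((bg.rad_contDiff.pow 2).inv fun _ =>
      pow_ne_zero 2 (bg.rad_pos _ _).ne')
  have hc := SmoothField.const
  exact (((hi.mul (smooth_ddot hX)).add
    (((hc 2).mul (hO.pow 2)).mul ((smooth_dot hξ).add (smooth_dot hζ)))).add
    (((hc 2).mul ((hO.pow 2).mul (hR.pow 2))).mul ((hs.pow 2).add (hp.pow 2)))).add
    (((hc e).mul ((hR.pow 3).mul hA)).mul (hr.add (hi.mul (smooth_sdiv hθ))))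

theorem smooth_densityU (hS : S.IsSmooth) : SmoothField (S.densityU bg) :=
  (smooth_fluxDensity bg 1 (SmoothField.smul bg.Om_contDiff hS.chih.1) hS.etab hS.betaF hS.etab
    hS.sigma1F hS.rho1F hS.Otrchi hS.rho1).congr_sphere fun u v _ hx => densityU_eq hS u v hx

theorem smooth_densityV (hS : S.IsSmooth) : SmoothField (S.densityV bg) :=
  (smooth_fluxDensity bg (-1) (SmoothField.smul bg.Om_contDiff hS.chihb.1) hS.eta hS.betabF hS.eta
    hS.sigma1F hS.rho1F hS.Otrchib hS.rho1).congr_sphere fun u v _ hx => densityV_eq hS u v hx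

theorem flux_conservation {R : Set (ℝ × ℝ)} (h : IsSolutionOn bg S R) {u₀ u₁ v₀ v₁ : ℝ}
    (hu : u₀ ≤ u₁) (hv : v₀ ≤ v₁) (hR : Set.Icc u₀ u₁ ×ˢ Set.Icc v₀ v₁ ⊆ R) :
    S.fluxU bg u₁ v₀ v₁ + S.fluxV bg v₁ u₀ u₁ = S.fluxU bg u₀ v₀ v₁ + S.fluxV bg v₀ u₀ u₁ := by
  refine flux_balance (smooth_densityU h.smooth) (smooth_densityV h.smooth) hu hv
    fun u hu' v hv' => ?_
  have hmem : (u, v) ∈ R := hR ⟨hu', hv'⟩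
  exact (isSphereDiv_fluxDensity h.smooth (h.nullStructure u v hmem) (h.maxwell u v hmem)
    (h.bianchi u v hmem)).integral_eq_zero

/-! ### Infinite endpoints -/

theorem fluxU_swap (u a b : ℝ) : S.fluxU bg u b a = -S.fluxU bg u a b :=
  intervalIntegral.integral_symm _ _

theorem fluxV_swap (v a b : ℝ) : S.fluxV bg v b a = -S.fluxV bg v a b :=
  intervalIntegral.integral_symm _ _

end Pert

instance approach_neBot (e : EReal) : (approach e).NeBot := by
  unfold approach
  split_ifs <;> infer_instance

/-- Strict inequality excludes `⊤`, the only endpoint approached from below. With its companion for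
upper endpoints, this keeps the finite rectangles inside the given one. -/
theorem eventually_approach_ge {e f : EReal} (h : e < f) : ∀ᶠ t : ℝ in approach e, e ≤ (t : EReal) := by
  induction e with
  | bot => simp
  | top => exact absurd h not_top_lt
  | coe x => simp [approach]

theorem eventually_approach_le {e f : EReal} (h : f < e) : ∀ᶠ t : ℝ in approach e, (t : EReal) ≤ e := by
  induction e with
  | bot => exact absurd h not_lt_bot
  | top => simp
  | coe x => simp [approach]

theorem eventually_approach_lt {e : EReal} {c : ℝ} (h : e < c) : ∀ᶠ t in approach e, t ≤ c := by
  induction e with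
  | bot => simpa [approach] using eventually_le_atBot c
  | top => exact absurd h not_top_lt
  | coe x => simpa [approach] using (EReal.coe_lt_coe_iff.1 h).le

theorem eventually_approach_gt {e : EReal} {c : ℝ} (h : c < e) : ∀ᶠ t in approach e, c ≤ t := by
  induction e with
  | bot => exact absurd h not_lt_bot
  | top => simpa [approach] using eventually_ge_atTop c
  | coe x => simpa [approach] using (EReal.coe_lt_coe_iff.1 h).le

/-- The filter is invariant under exchange of the last two parameters while `f` changes sign, so L =
−L. This handles an interval whose two endpoints are the same, possibly infinite, value, where the
approximating endpoints need not be ordered. -/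
theorem eq_zero_of_antisymm_limit {a e : EReal} {L : ℝ} {f : ℝ → ℝ → ℝ → ℝ}
    (hf : ∀ t s s', f t s' s = -f t s s')
    (h : Tendsto (fun p : ℝ × ℝ × ℝ => f p.1 p.2.1 p.2.2)
      (approach a ×ˢ (approach e ×ˢ approach e)) (𝓝 L)) : L = 0 := by
  have hswap : Tendsto (fun p : ℝ × ℝ × ℝ => (p.1, p.2.2, p.2.1))
      (approach a ×ˢ (approach e ×ˢ approach e)) (approach a ×ˢ (approach e ×ˢ approach e)) :=
    tendsto_fst.prodMk ((tendsto_snd.comp tendsto_snd).prodMk (tendsto_fst.comp tendsto_snd))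
  have h1 := h.comp hswap
  have h2 := tendsto_nhds_unique h1 (h.neg.congr fun p => (hf p.1 p.2.1 p.2.2).symm)
  linarith

theorem icc_subset_rectangle {u₀ u₁ v₀ v₁ : EReal} {a b c d : ℝ} (ha : u₀ ≤ a) (hb : (b : EReal) ≤ u₁)
    (hc : v₀ ≤ c) (hd : (d : EReal) ≤ v₁) :
    Set.Icc a b ×ˢ Set.Icc c d ⊆ rectangle u₀ u₁ v₀ v₁ := fun _ hp =>
  ⟨ha.trans (EReal.coe_le_coe_iff.2 hp.1.1), (EReal.coe_le_coe_iff.2 hp.1.2).trans hb,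
    hc.trans (EReal.coe_le_coe_iff.2 hp.2.1), (EReal.coe_le_coe_iff.2 hp.2.2).trans hd⟩

end EMDN

theorem proposition3p1 (bg : EMDN.RN) (S : EMDN.Pert) :
    (∀ u₀ u₁ v₀ v₁ : ℝ, u₀ ≤ u₁ → v₀ ≤ v₁ →
      EMDN.Pert.IsSolutionOn bg S (EMDN.rectangle u₀ u₁ v₀ v₁) →
      S.fluxU bg u₁ v₀ v₁ + S.fluxV bg v₁ u₀ u₁
        = S.fluxU bg u₀ v₀ v₁ + S.fluxV bg v₀ u₀ u₁) ∧
    (∀ u₀ u₁ v₀ v₁ : EReal, u₀ ≤ u₁ → v₀ ≤ v₁ →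
      EMDN.Pert.IsSolutionOn bg S (EMDN.rectangle u₀ u₁ v₀ v₁) →
      ∀ Eu₁ Ev₁ Eu₀ Ev₀ : ℝ,
        S.HasFluxU bg u₁ v₀ v₁ Eu₁ → S.HasFluxV bg v₁ u₀ u₁ Ev₁ →
        S.HasFluxU bg u₀ v₀ v₁ Eu₀ → S.HasFluxV bg v₀ u₀ u₁ Ev₀ →
        Eu₁ + Ev₁ = Eu₀ + Ev₀) := by
  refine ⟨fun u₀ u₁ v₀ v₁ hu hv h => EMDN.Pert.flux_conservation h hu hv
    (EMDN.icc_subset_rectangle le_rfl le_rfl le_rfl le_rfl), ?_⟩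
  intro u₀ u₁ v₀ v₁ hu hv h Eu₁ Ev₁ Eu₀ Ev₀ hEu₁ hEv₁ hEu₀ hEv₀
  -- If the u-endpoints coincide, the two outgoing fluxes are limits of one function along one
  -- filter, and both ingoing fluxes vanish; similarly for v.
  rcases hu.eq_or_lt with rfl | hu
  · rw [tendsto_nhds_unique hEu₁ hEu₀, EMDN.eq_zero_of_antisymm_limit EMDN.Pert.fluxV_swap hEv₁,
      EMDN.eq_zero_of_antisymm_limit EMDN.Pert.fluxV_swap hEv₀]
  rcases hv.eq_or_lt with rfl | hv
  · rw [tendsto_nhds_unique hEv₁ hEv₀, EMDN.eq_zero_of_antisymm_limit EMDN.Pert.fluxU_swap hEu₁,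
      EMDN.eq_zero_of_antisymm_limit EMDN.Pert.fluxU_swap hEu₀]
  -- A real number strictly between the endpoints eventually separates their finite approximations,
  -- so the approximating intervals are ordered.
  obtain ⟨c, hc₀, hc₁⟩ := EReal.lt_iff_exists_real_btwn.1 hu
  obtain ⟨d, hd₀, hd₁⟩ := EReal.lt_iff_exists_real_btwn.1 hv
  -- All four parameters vary independently under one filter, to which the limits of the four fluxes
  -- are pulled back; they can then be added and compared.
  let l : Filter ((ℝ × ℝ) × (ℝ × ℝ)) :=
    (EMDN.approach u₀ ×ˢ EMDN.approach u₁) ×ˢ (EMDN.approach v₀ ×ˢ EMDN.approach v₁)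
  have t₁ : Tendsto (fun p : (ℝ × ℝ) × (ℝ × ℝ) => p.1.1) l (EMDN.approach u₀) :=
    tendsto_fst.comp tendsto_fst
  have t₂ : Tendsto (fun p : (ℝ × ℝ) × (ℝ × ℝ) => p.1.2) l (EMDN.approach u₁) :=
    tendsto_snd.comp tendsto_fst
  have t₃ : Tendsto (fun p : (ℝ × ℝ) × (ℝ × ℝ) => p.2.1) l (EMDN.approach v₀) :=
    tendsto_fst.comp tendsto_snd
  have t₄ : Tendsto (fun p : (ℝ × ℝ) × (ℝ × ℝ) => p.2.2) l (EMDN.approach v₁) :=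
    tendsto_snd.comp tendsto_snd
  have L := (hEu₁.comp (t₂.prodMk (t₃.prodMk t₄))).add (hEv₁.comp (t₄.prodMk (t₁.prodMk t₂)))
  have R := (hEu₀.comp (t₁.prodMk (t₃.prodMk t₄))).add (hEv₀.comp (t₃.prodMk (t₁.prodMk t₂)))
  refine tendsto_nhds_unique L (R.congr' ?_)
  filter_upwards [t₁.eventually (EMDN.eventually_approach_ge hu),
    t₂.eventually (EMDN.eventually_approach_le hu), t₃.eventually (EMDN.eventually_approach_ge hv),
    t₄.eventually (EMDN.eventually_approach_le hv), t₁.eventually (EMDN.eventually_approach_lt hc₀),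
    t₂.eventually (EMDN.eventually_approach_gt hc₁), t₃.eventually (EMDN.eventually_approach_lt hd₀),
    t₄.eventually (EMDN.eventually_approach_gt hd₁)] with p h₁ h₂ h₃ h₄ h₅ h₆ h₇ h₈
  exact (EMDN.Pert.flux_conservation h (h₅.trans h₆) (h₇.trans h₈)
    (EMDN.icc_subset_rectangle h₁ h₂ h₃ h₄)).symm
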